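/- **Setting.** Let $\Omega$ be a Polish space with a finite Borel measure $\mu$ (in particular: a finite set with counting measure, or a bounded rectangle in $\mathbb R^p$ with Lebesgue measure). Suppose a system of recursive partitions of $\Omega$ is given: a family of measurable *elementary regions* of positive $\mu$-measure, containing $\Omega$, such that each elementary region $A$ comes with $M(A)\ge 0$ ways of partitioning it, the $j$-th one being a partition $A=\bigcup_{l=1}^{K^j(A)}A^j_l$ into finitely many disjoint elementary regions ($M(A)=0$ means that $A$ cannot be divided, e.g. a single point of a finite set). A *recursive partition* of finite depth is obtained from $\Omega$ by deciding, for each region produced, whether to stop or which way of partitioning to use. Assume that the system approximates open sets: for any open sets $B_1,\dots,B_m\subseteq\Omega$ and any $\eta>0$ there is one recursive partition of finite depth such that each $B_i$ differs from a union of its parts by a set of $\mu$-measure less than $\eta$. **Prior.** For each elementary region $A$ let a stopping probability $\rho(A)\in[0,1]$, selection probabilities $\lambda_1(A),\dots,\lambda_{M(A)}(A)\ge 0$ with sum $1$ (if $M(A)>0$), and assignment weights $\alpha^j_l(A)>0$ be fixed (non-random). Starting with $Q^{(0)}$ uniform on $\Omega$, the random measure $Q^{(k+1)}$ is obtained from $Q^{(k)}$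 as follows: independently for each region $A$ of the current partition that has not been stopped, with probability $\rho(A)$ (with probability $1$ if $M(A)=0$) $A$ is stopped; otherwise $J=j$ is drawn with probability $\lambda_j(A)$, $A$ is replaced by the parts $A^j_1,\dots,A^j_{K^j(A)}$, one sets $Q^{(k+1)}(A^j_l)=Q^{(k)}(A)\,\theta_l$ with $(\theta_l)_l\sim\mathrm{Dirichlet}(\alpha^j_1(A),\dots,\alpha^j_{K^j(A)}(A))$, and $Q^{(k+1)}$ is uniform within each part. Assume there is $\delta>0$ such that for all $A,j,l$: $\delta<\rho(A)<1-\delta$ (if $M(A)>0$), $\lambda_j(A)\ge\delta$, and $\delta\le\alpha^j_l(A)/\sum_i\alpha^j_i(A)\le 1-\delta$. Then almost surely $Q^{(k)}$ converges in variational distance to a random probability measure $Q$; its law $\pi$ is the *optional Pólya tree* prior. For each $n$ let $\pi(\cdot\mid x_1,\dots,x_n)$ be the posterior distribution, that is, (any version of) the regular conditional distribution of $Q\sim\pi$ given observations $x_1,\dots,x_n$ which, conditionally on $Q$, are independent with law $Q$. **Theorem.** Let $Q_0$ be a probability measure on $\Omega$ that has a bounded density with respect to $\mu$. Then, for $Q_0^{\infty}$-almost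 every sequence $(x_1,x_2,\dots)$, $$\pi(U\mid x_1,\dots,x_n)\longrightarrow 1\qquad\text{as } n\to\infty,\ \text{for every weak neighborhood } U \text{ of } Q_0 .$$ -/

import Mathlib

open MeasureTheory ProbabilityTheory Filter Topology
open scoped ENNReal NNReal

noncomputable section

namespace OptionalPolyaTree

/-- A system of recursive partitions of the sample space `X` (with base measure `μ`). The elementary
regions are labelled by `N`. The region labelled `A` can be partitioned in `numWays A` ways, and the
`j`-th way cuts it into the `numParts A j` disjoint elementary regions `child A j l`. A region with
`numWays A = 0` cannot be divided further (for instance a single point of a finite space). -/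
structure PartitionScheme {X : Type*} [MeasurableSpace X] (μ : Measure X) (N : Type*) where
  root : N
  numWays : N → ℕ
  numParts : (A : N) → Fin (numWays A) → ℕ
  child : (A : N) → (j : Fin (numWays A)) → Fin (numParts A j) → N
  region : N → Set X
  region_root : region root = Set.univ
  measurableSet_region : ∀ A, MeasurableSet (region A)
  measure_region_pos : ∀ A, 0 < μ (region A)
  disjoint_child : ∀ A j, Pairwise fun l l' =>
    Disjoint (region (child A j l)) (region (child A j l'))
  iUnion_child : ∀ A j, ⋃ l, region (child A j l) = region A

/-- The parameters of an optional Pólya tree with independent stopping rule: stopping probabilities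
`rho A`, selection probabilities `lam A j`, assignment weights `alpha A j l`. At a region that
cannot be divided the value of `rho` is irrelevant. -/
structure Params {X : Type*} [MeasurableSpace X] {μ : Measure X} {N : Type*}
    (T : PartitionScheme μ N) where
  rho : N → ℝ
  lam : (A : N) → Fin (T.numWays A) → ℝ
  alpha : (A : N) → (j : Fin (T.numWays A)) → Fin (T.numParts A j) → ℝ
  rho_nonneg : ∀ A, 0 ≤ rho A
  rho_le_one : ∀ A, rho A ≤ 1
  lam_nonneg : ∀ A j, 0 ≤ lam A j
  sum_lam : ∀ A, T.numWays A ≠ 0 → ∑ j, lam A j = 1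
  alpha_pos : ∀ A j l, 0 < alpha A j l

/-- The Dirichlet distribution with parameter `a`: the law of the normalization of independent
`Gamma (a i, 1)` variables. -/
def dirichlet {K : ℕ} (a : Fin K → ℝ) : Measure (Fin K → ℝ) :=
  (Measure.pi fun i => gammaMeasure (a i) 1).map fun g i => g i / ∑ l, g l

theorem isProbabilityMeasure_dirichlet {K : ℕ} {a : Fin K → ℝ} (ha : ∀ i, 0 < a i) :
    IsProbabilityMeasure (dirichlet a) := by
  have : ∀ i, IsProbabilityMeasure (gammaMeasure (a i) 1) := fun i =>
    isProbabilityMeasure_gammaMeasure (ha i) one_pos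
  refine Measure.isProbabilityMeasure_map (Measurable.aemeasurable ?_)
  fun_prop

/-- The decision made at a region with `M` ways of partitioning it: halt (`S = 1`), or do not halt
and use the `j`-th way (`S = 0` and `J = j`). -/
inductive Decision (M : ℕ) : Type
  | halt : Decision M
  | split (j : Fin M) : Decision M

instance (M : ℕ) : MeasurableSpace (Decision M) := ⊤

/-- The law of the decision: halt with probability `r`, and otherwise select the way `j` with
probability `p j`; with no way of partitioning one always halts. -/
def decisionLaw {M : ℕ} (r : ℝ) (p : Fin M → ℝ) : Measure (Decision M) :=
  if M = 0 then Measure.dirac Decision.halt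
  else ENNReal.ofReal r • Measure.dirac Decision.halt +
    ∑ j, ENNReal.ofReal ((1 - r) * p j) • Measure.dirac (Decision.split j)

theorem isProbabilityMeasure_decisionLaw {M : ℕ} {r : ℝ} {p : Fin M → ℝ} (hr : 0 ≤ r)
    (hr1 : r ≤ 1) (hp : ∀ j, 0 ≤ p j) (hsum : M ≠ 0 → ∑ j, p j = 1) :
    IsProbabilityMeasure (decisionLaw r p) := by
  unfold decisionLaw
  split_ifs with h
  · infer_instance
  · constructor
    have h0 : ∀ j ∈ Finset.univ, 0 ≤ (1 - r) * p j := fun j _ =>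
      mul_nonneg (by linarith) (hp j)
    simp only [Measure.add_apply, Measure.smul_apply, measure_univ, smul_eq_mul, mul_one,
      Measure.finsetSum_apply]
    rw [← ENNReal.ofReal_sum_of_nonneg h0, ← Finset.mul_sum, hsum h,
      ← ENNReal.ofReal_add hr (by linarith)]
    simp

section

variable {X : Type*} [MeasurableSpace X] {μ : Measure X} {N : Type*}

/-- The random variables attached to an elementary region `A`: the decision, and for every way `j`
of partitioning `A` the vector of conditional probabilities of the parts. -/
abbrev PartitionScheme.Draw (T : PartitionScheme μ N) (A : N) : Type :=
  Decision (T.numWays A) × ((j : Fin (T.numWays A)) → Fin (T.numParts A j) → ℝ)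

instance {T : PartitionScheme μ N} (P : Params T) (A : N) :
    IsProbabilityMeasure
      ((decisionLaw (P.rho A) (P.lam A)).prod (Measure.pi fun j => dirichlet (P.alpha A j))) := by
  have := isProbabilityMeasure_decisionLaw (P.rho_nonneg A) (P.rho_le_one A) (P.lam_nonneg A)
    (P.sum_lam A)
  have := fun j => isProbabilityMeasure_dirichlet (P.alpha_pos A j)
  infer_instance

/-- The joint law of all the random variables of the tree, which are independent. -/
def Params.treeLaw {T : PartitionScheme μ N} (P : Params T) : Measure ((A : N) → T.Draw A) :=
  Measure.infinitePi fun A =>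
    (decisionLaw (P.rho A) (P.lam A)).prod (Measure.pi fun j => dirichlet (P.alpha A j))

/-- The conditional distribution inside the region `A` after `k` further steps of the recursion. -/
def PartitionScheme.stage (T : PartitionScheme μ N) (ω : (A : N) → T.Draw A) :
    ℕ → N → Measure X
  | 0, A => μ[|T.region A]
  | k + 1, A =>
    match (ω A).1 with
    | Decision.halt => μ[|T.region A]
    | Decision.split j => ∑ l, ENNReal.ofReal ((ω A).2 j l) • T.stage ω k (T.child A j l)

/-- Convergence in variational distance, that is, uniformly over the measurable sets. -/
def TendstoVariation (Qs : ℕ → Measure X) (Q : Measure X) : Prop :=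
  TendstoUniformlyOn (fun k B => (Qs k).real B) (fun B => Q.real B) atTop {B | MeasurableSet B}

/-- The uniform distribution on the whole space. -/
def PartitionScheme.uniform (T : PartitionScheme μ N) [IsFiniteMeasure μ] : ProbabilityMeasure X :=
  ⟨μ[|T.region T.root], cond_isProbabilityMeasure (T.measure_region_pos T.root).ne'⟩

open Classical in
/-- The random probability measure `Q`: the limit in variational distance of the measures `Q^(k)`
obtained after `k` steps of the recursion. (The uniform distribution, should there be no limit.) -/
def PartitionScheme.limitMeasure (T : PartitionScheme μ N) [IsFiniteMeasure μ]
    (ω : (A : N) → T.Draw A) : ProbabilityMeasure X :=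
  if h : ∃ Q : ProbabilityMeasure X,
      TendstoVariation (fun k => T.stage ω k T.root) (Q : Measure X)
  then h.choose else T.uniform

/-- The optional Pólya tree distribution with parameters `P`, as a distribution on the space of
probability measures on `X`. -/
def Params.prior {T : PartitionScheme μ N} [IsFiniteMeasure μ] (P : Params T) :
    Measure (ProbabilityMeasure X) :=
  P.treeLaw.map T.limitMeasure

/-- The stopping probabilities, the selection probabilities and the assignment probabilities
(the means of the Dirichlet variables) are uniformly bounded away from `0` and `1`; the selection
probability of a unique way of partitioning may be `1`. -/
def Params.UniformlyBounded {T : PartitionScheme μ N} (P : Params T) : Prop :=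
  ∃ δ : ℝ, 0 < δ ∧ ∀ A,
    (T.numWays A ≠ 0 → δ < P.rho A ∧ P.rho A < 1 - δ) ∧
    ∀ j, δ ≤ P.lam A j ∧ ∀ l,
      δ ≤ P.alpha A j l / ∑ i, P.alpha A j i ∧ P.alpha A j l / ∑ i, P.alpha A j i ≤ 1 - δ

/-- The recursive partitions of finite depth of a region: the decisions, for each region produced,
whether to halt and if not which way of partitioning to use. -/
inductive PartitionScheme.RecPartition (T : PartitionScheme μ N) : N → Type _
  | halt (A : N) : T.RecPartition A
  | split (A : N) (j : Fin (T.numWays A)) (sub : ∀ l, T.RecPartition (T.child A j l)) :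
      T.RecPartition A

/-- The parts of a recursive partition. -/
def PartitionScheme.RecPartition.parts {T : PartitionScheme μ N} :
    {A : N} → T.RecPartition A → Set (Set X)
  | A, .halt _ => {T.region A}
  | _, .split _ _ sub => ⋃ l, (sub l).parts

/-- Open sets are approximated by unions of elementary regions: for any finitely many open sets
there is a recursive partition of the space such that each of them is a union of parts up to a set
of small measure. -/
def PartitionScheme.ApproximatesOpenSets [TopologicalSpace X] (T : PartitionScheme μ N) : Prop :=
  ∀ 𝓑 : Set (Set X), 𝓑.Finite → (∀ B ∈ 𝓑, IsOpen B) → ∀ η : ℝ≥0∞, 0 < η →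
    ∃ R : T.RecPartition T.root, ∀ B ∈ 𝓑, ∃ S ⊆ R.parts, μ (symmDiff B (⋃₀ S)) < η

/-- The joint law of `(x, Q)` where `Q` has law `π` and, given `Q`, `x = (x_1, …, x_n)` are
independent observations from `Q`. -/
def jointLaw (π : Measure (ProbabilityMeasure X)) (n : ℕ) :
    Measure ((Fin n → X) × ProbabilityMeasure X) :=
  π.bind fun Q => (Measure.pi fun _ : Fin n => (Q : Measure X)).prod (Measure.dirac Q)

/-- `post` is the posterior distribution of `Q` for the prior `π` and `n` observations, that is, a
regular conditional distribution of `Q` given `(x_1, …, x_n)`. -/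
def IsPosterior (π : Measure (ProbabilityMeasure X)) (n : ℕ)
    (post : Kernel (Fin n → X) (ProbabilityMeasure X)) : Prop :=
  IsMarkovKernel post ∧ (jointLaw π n).IsCondKernel post

end

end OptionalPolyaTree

end

/-! The argument is Schwartz's: a lower bound on the marginal likelihood up to small exponential
factors, against tests with exponentially small error. The lower bound is `ChargesVicinity`: the
marginal law m_n of the observations satisfies ν^n ≤ c a^n m_n for some ν with ∫ (dQ₀/dν)² dν ≤ a,
where a > 1 is arbitrary. If Q^n(D) is exponentially small for all Q in B, disintegration gives ∫_D
π(B | x) dm_n = ∫_B Q^n(D) dπ; the domination carries this bound to ν^n, and Cauchy–Schwarz carries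
it to Q₀^n (`ChargesVicinity.exists_setLIntegral_le`). Weak neighbourhoods are governed by integrals
of bounded continuous functions, and a Chernoff bound for sample means supplies D.

The prior charges the vicinity of Q₀ for two reasons. A bounded density is close in χ² to a strictly
positive density that is constant on the parts of a finite recursive partition
(`exists_chiSquare_le`). For such a ν, finitely many draws force Q ≥ ν/a, and with positive
probability: the decisions follow the partition and then halt, and the Dirichlet vectors nearly
dominate the conditional probabilities of ν (`Params.exists_box`). On this event ν^n ≤ a^n Q^n, and
averaging over the prior gives the bound.

The random measure Q exists because the expected mass not yet halted decays geometrically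
(`Params.lintegral_activeMass_le`). -/

noncomputable section

namespace OptionalPolyaTree

/-! ### Posterior consistency from a marginal likelihood bound -/

section PosteriorConsistency

/-- The integral of a product of functions of independent coordinates. -/
theorem lintegral_pi_prod {X ι : Type*} [MeasurableSpace X] [Fintype ι] (ν : Measure X)
    [IsProbabilityMeasure ν] {g : ι → X → ℝ≥0∞} (hg : ∀ i, Measurable (g i)) :
    ∫⁻ x, ∏ i, g i (x i) ∂(Measure.pi fun _ : ι => ν) = ∏ i, ∫⁻ x, g i x ∂ν := by
  have hind := iIndepFun_pi (μ := fun _ : ι => ν) (X := g) (fun i => (hg i).aemeasurable)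
  refine (lintegral_prod_eq_prod_lintegral_of_indepFun Finset.univ
    (fun i (x : ι → X) => g i (x i)) hind
    (fun i => (hg i).comp (measurable_pi_apply i))).trans ?_
  refine Finset.prod_congr rfl fun i _ => ?_
  exact (measurePreserving_eval (fun _ : ι => ν) i).lintegral_comp (hg i)

theorem pi_withDensity {X ι : Type*} [MeasurableSpace X] [Fintype ι] {ν Q : Measure X}
    [IsProbabilityMeasure ν] [IsProbabilityMeasure Q] {h : X → ℝ≥0∞} (hh : Measurable h)
    (hQ : Q = ν.withDensity h) :
    (Measure.pi fun _ : ι => Q) =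
      (Measure.pi fun _ : ι => ν).withDensity fun x => ∏ i, h (x i) := by
  refine Measure.pi_eq fun s hs => ?_
  rw [withDensity_apply _ (MeasurableSet.univ_pi hs),
    ← lintegral_indicator (MeasurableSet.univ_pi hs)]
  have : ((Set.univ.pi s).indicator fun x : ι → X => ∏ i, h (x i)) =
      fun x => ∏ i, (s i).indicator h (x i) := by
    classical
    funext x
    by_cases hx : x ∈ Set.univ.pi s
    · rw [Set.indicator_of_mem hx]
      exact Finset.prod_congr rfl fun i _ =>
        (Set.indicator_of_mem (hx i (Set.mem_univ i)) h).symm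
    · rw [Set.indicator_of_notMem hx]
      simp only [Set.mem_pi, Set.mem_univ, true_implies, not_forall] at hx
      obtain ⟨i, hi⟩ := hx
      exact (Finset.prod_eq_zero (Finset.mem_univ i) (Set.indicator_of_notMem hi h)).symm
  rw [this, lintegral_pi_prod ν fun i => hh.indicator (hs i)]
  refine Finset.prod_congr rfl fun i _ => ?_
  rw [lintegral_indicator (hs i), hQ, withDensity_apply _ (hs i)]

theorem pi_apply_le_of_smul_le {X : Type*} [MeasurableSpace X] {ν Q : Measure X}
    [IsProbabilityMeasure ν] [IsProbabilityMeasure Q] {a : ℝ≥0∞}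
    (ha : a ≠ ∞) (h : ν ≤ a • Q) (n : ℕ) (D : Set (Fin n → X)) :
    (Measure.pi fun _ : Fin n => ν) D ≤ a ^ n * (Measure.pi fun _ : Fin n => Q) D := by
  have hle : (Measure.pi fun _ : Fin n => ν) ≤ Measure.pi fun _ : Fin n => a • Q := by
    refine Measure.le_iff.2 fun s hs => ?_
    -- The product outer measure is the largest one bounded by the product on boxes, so the
    -- comparison needs checking on boxes only.
    conv_rhs => rw [Measure.pi, toMeasure_apply _ _ hs]
    suffices H : (Measure.pi fun _ : Fin n => ν).toOuterMeasure ≤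
        OuterMeasure.pi fun _ : Fin n => (a • Q).toOuterMeasure from H s
    rw [OuterMeasure.le_pi]
    intro s _
    calc (Measure.pi fun _ : Fin n => ν) (Set.univ.pi s) = ∏ i, ν (s i) := Measure.pi_pi _ _
      _ ≤ _ := Finset.prod_le_prod' fun i _ => h (s i)
  have hfin : IsFiniteMeasure (a • Q) := by
    constructor
    simpa using Ne.lt_top ha
  have heq : (Measure.pi fun _ : Fin n => a • Q) = a ^ n • Measure.pi fun _ : Fin n => Q := by
    refine Measure.pi_eq fun s _ => ?_
    simp [Finset.prod_mul_distrib]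
  calc _ ≤ (Measure.pi fun _ : Fin n => a • Q) D := hle D
    _ = _ := by rw [heq]; simp

/-- A Chernoff bound for the sample mean of a bounded function, uniform over the distributions
with a given lower bound on the mean. -/
theorem exists_pi_sum_le_le {X : Type*} [MeasurableSpace X] {g : X → ℝ} (hg : Measurable g)
    {M : ℝ} (hM : ∀ x, |g x| ≤ M) {e : ℝ} (he : 0 < e) :
    ∃ κ : ℝ, 0 < κ ∧ ∀ (Q : Measure X) [IsProbabilityMeasure Q] (a : ℝ), a + e ≤ ∫ x, g x ∂Q →
      ∀ n : ℕ, (Measure.pi fun _ : Fin n => Q) {x | ∑ i, g (x i) ≤ n * a} ≤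
        ENNReal.ofReal (Real.exp (-(4 * κ))) ^ n := by
  set L : ℝ := max M 1
  have hL : 1 ≤ L := le_max_right _ _
  have hgL : ∀ x, |g x| ≤ L := fun x => (hM x).trans (le_max_left _ _)
  -- The bound t ≤ 1/L gives |t g| ≤ 1, where exp u ≤ 1 + u + u². The other bound keeps the
  -- quadratic term below t e/2, half of the gain t e in the linear term. The remaining rate t e/2
  -- is 4κ, and t depends only on the bound for g and on e, not on Q.
  set t : ℝ := min (1 / L) (e / (2 * L ^ 2))
  have ht : 0 < t := lt_min (by positivity) (by positivity)
  have htL : t * L ≤ 1 := by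
    calc t * L ≤ 1 / L * L := by gcongr; exact min_le_left _ _
      _ = 1 := by field_simp
  have hte : t * L ^ 2 ≤ e / 2 := by
    calc t * L ^ 2 ≤ e / (2 * L ^ 2) * L ^ 2 := by gcongr; exact min_le_right _ _
      _ = e / 2 := by field_simp
  refine ⟨t * e / 8, by positivity, fun Q _ a ha n => ?_⟩
  have hgi : Integrable g Q :=
    Integrable.of_bound hg.aestronglyMeasurable L (ae_of_all _ fun x => hgL x)
  have hmeas : Measurable fun x => Real.exp (t * (a - g x)) := by fun_prop
  have hpt : ∀ x, Real.exp (-(t * g x)) ≤ 1 - t * g x + t ^ 2 * L ^ 2 := fun x => by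
    have h1 : |-(t * g x)| ≤ 1 := by
      rw [abs_neg, abs_mul, abs_of_pos ht]
      exact (mul_le_mul_of_nonneg_left (hgL x) ht.le).trans htL
    have h2 := (abs_le.1 (Real.abs_exp_sub_one_sub_id_le h1)).2
    have h3 : (g x) ^ 2 ≤ L ^ 2 := sq_le_sq' (abs_le.1 (hgL x)).1 (abs_le.1 (hgL x)).2
    nlinarith [mul_le_mul_of_nonneg_left h3 (sq_nonneg t)]
  have hone : ∫⁻ x, ENNReal.ofReal (Real.exp (t * (a - g x))) ∂Q ≤
      ENNReal.ofReal (Real.exp (-(4 * (t * e / 8)))) := by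
    have hle : ∀ x, Real.exp (t * (a - g x)) ≤
        Real.exp (t * a) * (1 - t * g x + t ^ 2 * L ^ 2) := fun x => by
      rw [show t * (a - g x) = t * a + -(t * g x) by ring, Real.exp_add]
      exact mul_le_mul_of_nonneg_left (hpt x) (Real.exp_pos _).le
    have hint : Integrable (fun x => Real.exp (t * a) * (1 - t * g x + t ^ 2 * L ^ 2)) Q := by
      refine Integrable.const_mul ?_ _
      exact ((integrable_const _).sub (hgi.const_mul t)).add (integrable_const _)
    calc ∫⁻ x, ENNReal.ofReal (Real.exp (t * (a - g x))) ∂Q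
        ≤ ∫⁻ x, ENNReal.ofReal (Real.exp (t * a) * (1 - t * g x + t ^ 2 * L ^ 2)) ∂Q :=
          lintegral_mono fun x => ENNReal.ofReal_le_ofReal (hle x)
      _ = ENNReal.ofReal (∫ x, Real.exp (t * a) * (1 - t * g x + t ^ 2 * L ^ 2) ∂Q) :=
          (ofReal_integral_eq_lintegral_ofReal hint
            (ae_of_all _ fun x => (Real.exp_pos _).le.trans (hle x))).symm
      _ ≤ _ := by
          refine ENNReal.ofReal_le_ofReal ?_
          have h0 : ∫ x, (1 - t * g x + t ^ 2 * L ^ 2) ∂Q =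
              1 - t * ∫ x, g x ∂Q + t ^ 2 * L ^ 2 := by
            have hi : Integrable (fun x => 1 - t * g x) Q :=
              (integrable_const _).sub (hgi.const_mul t)
            rw [integral_add hi (integrable_const _),
              integral_sub (integrable_const _) (hgi.const_mul t), integral_const_mul]
            simp
          rw [integral_const_mul, h0]
          have h1 : 1 - t * ∫ x, g x ∂Q + t ^ 2 * L ^ 2 ≤ Real.exp (-(t * (a + e / 2))) := by
            refine le_trans ?_ (Real.add_one_le_exp _)
            nlinarith [mul_le_mul_of_nonneg_left ha ht.le, mul_le_mul_of_nonneg_left hte ht.le]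
          calc _ ≤ Real.exp (t * a) * Real.exp (-(t * (a + e / 2))) :=
                mul_le_mul_of_nonneg_left h1 (Real.exp_pos _).le
            _ = _ := by rw [← Real.exp_add]; congr 1; ring
  have hset : MeasurableSet {x : Fin n → X | ∑ i, g (x i) ≤ n * a} :=
    measurableSet_le (by fun_prop) measurable_const
  calc (Measure.pi fun _ : Fin n => Q) {x | ∑ i, g (x i) ≤ n * a}
      = ∫⁻ x, Set.indicator {x : Fin n → X | ∑ i, g (x i) ≤ n * a} 1 x
          ∂(Measure.pi fun _ : Fin n => Q) := (lintegral_indicator_one hset).symm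
    _ ≤ ∫⁻ x, ∏ i, ENNReal.ofReal (Real.exp (t * (a - g (x i))))
          ∂(Measure.pi fun _ : Fin n => Q) := by
        refine lintegral_mono fun x => ?_
        refine Set.indicator_apply_le' (fun hx => ?_) fun _ => zero_le
        rw [← ENNReal.ofReal_prod_of_nonneg fun i _ => (Real.exp_pos _).le, ← Real.exp_sum,
          Pi.one_apply, ENNReal.one_le_ofReal, Real.one_le_exp_iff, ← Finset.mul_sum,
          Finset.sum_sub_distrib]
        simp only [Finset.sum_const, Finset.card_univ, Fintype.card_fin, nsmul_eq_mul]
        exact mul_nonneg ht.le (sub_nonneg.2 hx)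
    _ = ∏ _i : Fin n, ∫⁻ x, ENNReal.ofReal (Real.exp (t * (a - g x))) ∂Q :=
        lintegral_pi_prod Q (g := fun _ x => ENNReal.ofReal (Real.exp (t * (a - g x))))
          fun _ => hmeas.ennreal_ofReal
    _ ≤ _ := by
        rw [Finset.prod_const, Finset.card_univ, Fintype.card_fin]
        gcongr

variable {X : Type*} [MeasurableSpace X]

theorem measurable_pi_probabilityMeasure (n : ℕ) :
    Measurable fun Q : ProbabilityMeasure X => Measure.pi fun _ : Fin n => (Q : Measure X) := by
  refine Measurable.measure_of_isPiSystem_of_isProbabilityMeasure generateFrom_pi.symm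
    isPiSystem_pi ?_
  rintro _ ⟨s, hs, rfl⟩
  simp only [Measure.pi_pi]
  exact Finset.measurable_prod _ fun i _ =>
    (Measure.measurable_coe (hs i (Set.mem_univ i))).comp measurable_subtype_coe

theorem measurable_jointLaw_kernel (n : ℕ) :
    Measurable fun Q : ProbabilityMeasure X =>
      (Measure.pi fun _ : Fin n => (Q : Measure X)).prod (Measure.dirac Q) := by
  refine Measurable.measure_of_isPiSystem_of_isProbabilityMeasure generateFrom_prod.symm
    isPiSystem_prod ?_
  rintro _ ⟨D, hD, B, hB, rfl⟩
  rw [Set.mem_ofPred_eq] at hD hB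
  simp only [Measure.prod_prod]
  refine ((Measure.measurable_coe hD).comp (measurable_pi_probabilityMeasure n)).mul ?_
  exact (Measure.measurable_coe hB).comp Measure.measurable_dirac

theorem jointLaw_prod (π : Measure (ProbabilityMeasure X)) (n : ℕ) {D : Set (Fin n → X)}
    (hD : MeasurableSet D) {B : Set (ProbabilityMeasure X)} (hB : MeasurableSet B) :
    jointLaw π n (D ×ˢ B) =
      ∫⁻ Q in B, (Measure.pi fun _ : Fin n => (Q : Measure X)) D ∂π := by
  rw [jointLaw, Measure.bind_apply (hD.prod hB) (measurable_jointLaw_kernel n).aemeasurable,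
    ← lintegral_indicator hB]
  refine lintegral_congr fun Q => ?_
  rw [Measure.prod_prod, Measure.dirac_apply' _ hB]
  by_cases hQ : Q ∈ B <;> simp [hQ]

theorem fst_jointLaw_apply (π : Measure (ProbabilityMeasure X)) (n : ℕ) {D : Set (Fin n → X)}
    (hD : MeasurableSet D) :
    (jointLaw π n).fst D = ∫⁻ Q, (Measure.pi fun _ : Fin n => (Q : Measure X)) D ∂π := by
  rw [Measure.fst_apply hD, ← Set.prod_univ, jointLaw_prod π n hD MeasurableSet.univ,
    Measure.restrict_univ]

instance (π : Measure (ProbabilityMeasure X)) [IsProbabilityMeasure π] (n : ℕ) :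
    IsProbabilityMeasure (jointLaw π n) := by
  constructor
  rw [← Set.univ_prod_univ, jointLaw_prod π n MeasurableSet.univ MeasurableSet.univ]
  simp

theorem IsPosterior.setLIntegral_eq {π : Measure (ProbabilityMeasure X)} [IsProbabilityMeasure π]
    {n : ℕ} {post : Kernel (Fin n → X) (ProbabilityMeasure X)} (h : IsPosterior π n post)
    {D : Set (Fin n → X)} (hD : MeasurableSet D) {B : Set (ProbabilityMeasure X)}
    (hB : MeasurableSet B) :
    ∫⁻ x in D, post x B ∂(jointLaw π n).fst =
      ∫⁻ Q in B, (Measure.pi fun _ : Fin n => (Q : Measure X)) D ∂π := by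
  have := h.1
  rw [← jointLaw_prod π n hD hB, ← Measure.compProd_apply_prod hD hB, h.2.disintegrate]

/-- The prior `π` charges the vicinity of `Q₀`: up to factors of arbitrarily small exponential
growth, the marginal law of the observations dominates the law of independent observations from
some `ν` whose `χ²`-distance from `Q₀` is arbitrarily small. -/
def ChargesVicinity (π : Measure (ProbabilityMeasure X)) (Q₀ : Measure X) : Prop :=
  ∀ a : ℝ≥0∞, 1 < a → ∃ (ν : Measure X) (h : X → ℝ≥0∞) (c : ℝ≥0∞), IsProbabilityMeasure ν ∧
    Measurable h ∧ Q₀ = ν.withDensity h ∧ ∫⁻ x, h x ^ 2 ∂ν ≤ a ∧ c ≠ ∞ ∧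
    ∀ n : ℕ, (Measure.pi fun _ : Fin n => ν) ≤ (c * a ^ n) • (jointLaw π n).fst

/-- The posterior mass of a set of distributions under which the samples in `D` are exponentially
unlikely is small on `D`. -/
theorem ChargesVicinity.exists_setLIntegral_le {π : Measure (ProbabilityMeasure X)}
    [IsProbabilityMeasure π] {Q₀ : Measure X} [IsProbabilityMeasure Q₀]
    (hπ : ChargesVicinity π Q₀) {κ : ℝ} (hκ : 0 < κ) :
    ∃ c : ℝ≥0∞, c ≠ ∞ ∧ ∀ (n : ℕ) (post : Kernel (Fin n → X) (ProbabilityMeasure X)),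
      IsPosterior π n post → ∀ (D : Set (Fin n → X)) (B : Set (ProbabilityMeasure X)),
      MeasurableSet D → MeasurableSet B →
      (∀ Q ∈ B, (Measure.pi fun _ : Fin n => (Q : Measure X)) D ≤
        ENNReal.ofReal (Real.exp (-(4 * κ))) ^ n) →
      ∫⁻ x in D, post x B ∂(Measure.pi fun _ : Fin n => Q₀) ≤
        c * ENNReal.ofReal (Real.exp (-κ)) ^ n := by
  -- Budget of rates: the test gives -4κ and the domination costs κ, which leaves -3κ for ∫ F². The
  -- χ² factor costs κ, and the square root in Cauchy–Schwarz turns -3κ + κ into -κ.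
  obtain ⟨ν, h, c, hν, hh, hQ₀, hh2, hc, hdom⟩ :=
    hπ (ENNReal.ofReal (Real.exp κ)) (by simpa using hκ)
  refine ⟨c ^ (1 / 2 : ℝ), ENNReal.rpow_ne_top_of_nonneg (by norm_num) hc, ?_⟩
  intro n post hpost D B hD hB hDB
  have := hpost.1
  have hpm : Measurable fun x => post x B := Kernel.measurable_coe post hB
  have hprod : Measurable fun x : Fin n → X => ∏ i, h (x i) :=
    Finset.measurable_prod _ fun i _ => hh.comp (measurable_pi_apply i)
  set F : (Fin n → X) → ℝ≥0∞ := D.indicator fun x => post x B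
  have hF : Measurable F := hpm.indicator hD
  have hF2 : ∫⁻ x, F x ^ (2 : ℝ) ∂(Measure.pi fun _ : Fin n => ν) ≤
      c * ENNReal.ofReal (Real.exp (-(3 * κ))) ^ n := by
    calc ∫⁻ x, F x ^ (2 : ℝ) ∂(Measure.pi fun _ : Fin n => ν)
        ≤ ∫⁻ x, F x ∂(Measure.pi fun _ : Fin n => ν) := by
          refine lintegral_mono fun x => ?_
          have h1 : F x ≤ 1 := Set.indicator_apply_le' (fun _ => prob_le_one) fun _ => zero_le
          calc F x ^ (2 : ℝ) = F x * F x := by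
                rw [ENNReal.rpow_two, sq]
            _ ≤ F x * 1 := by gcongr
            _ = F x := mul_one _
      _ ≤ ∫⁻ x, F x ∂((c * ENNReal.ofReal (Real.exp κ) ^ n) • (jointLaw π n).fst) :=
          lintegral_mono' (hdom n) le_rfl
      _ = c * ENNReal.ofReal (Real.exp κ) ^ n *
            ∫⁻ Q in B, (Measure.pi fun _ : Fin n => (Q : Measure X)) D ∂π := by
          rw [lintegral_smul_measure, lintegral_indicator hD, hpost.setLIntegral_eq hD hB,
            smul_eq_mul]
      _ ≤ c * ENNReal.ofReal (Real.exp κ) ^ n *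
            ENNReal.ofReal (Real.exp (-(4 * κ))) ^ n := by
          gcongr
          calc _ ≤ ∫⁻ Q in B, ENNReal.ofReal (Real.exp (-(4 * κ))) ^ n ∂π :=
                setLIntegral_mono' hB hDB
            _ ≤ _ := by
                rw [setLIntegral_const]
                exact mul_le_of_le_one_right zero_le prob_le_one
      _ = _ := by
          rw [mul_assoc, ← mul_pow, ← ENNReal.ofReal_mul (Real.exp_pos _).le, ← Real.exp_add]
          congr 4
          ring
  have hG2 : ∫⁻ x, (∏ i, h (x i)) ^ (2 : ℝ) ∂(Measure.pi fun _ : Fin n => ν) ≤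
      ENNReal.ofReal (Real.exp κ) ^ n := by
    calc ∫⁻ x, (∏ i, h (x i)) ^ (2 : ℝ) ∂(Measure.pi fun _ : Fin n => ν)
        = ∫⁻ x, ∏ i, h (x i) ^ 2 ∂(Measure.pi fun _ : Fin n => ν) := by
          simp only [ENNReal.rpow_two, Finset.prod_pow]
      _ = ∏ _i : Fin n, ∫⁻ x, h x ^ 2 ∂ν :=
          lintegral_pi_prod ν (g := fun _ x => h x ^ 2) fun _ => hh.pow_const 2
      _ ≤ _ := by
          rw [Finset.prod_const, Finset.card_univ, Fintype.card_fin]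
          gcongr
  have hrt : ∀ y : ℝ, (ENNReal.ofReal (Real.exp y) ^ n) ^ (1 / 2 : ℝ) =
      ENNReal.ofReal (Real.exp (y / 2)) ^ n := fun y => by
    rw [← ENNReal.rpow_natCast, ← ENNReal.rpow_mul, mul_comm, ENNReal.rpow_mul,
      ENNReal.rpow_natCast, ENNReal.ofReal_rpow_of_pos (Real.exp_pos _), ← Real.exp_mul]
    congr 4
    ring
  calc ∫⁻ x in D, post x B ∂(Measure.pi fun _ : Fin n => Q₀)
      = ∫⁻ x, F x * ∏ i, h (x i) ∂(Measure.pi fun _ : Fin n => ν) := by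
        rw [← lintegral_indicator hD, pi_withDensity (ι := Fin n) hh hQ₀,
          lintegral_withDensity_eq_lintegral_mul _ hprod hF]
        exact lintegral_congr fun x => mul_comm _ _
    _ ≤ (∫⁻ x, F x ^ (2 : ℝ) ∂(Measure.pi fun _ : Fin n => ν)) ^ (1 / 2 : ℝ) *
          (∫⁻ x, (∏ i, h (x i)) ^ (2 : ℝ) ∂(Measure.pi fun _ : Fin n => ν)) ^ (1 / 2 : ℝ) :=
        ENNReal.lintegral_mul_le_Lp_mul_Lq _ Real.HolderConjugate.two_two hF.aemeasurable
          hprod.aemeasurable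
    _ ≤ (c * ENNReal.ofReal (Real.exp (-(3 * κ))) ^ n) ^ (1 / 2 : ℝ) *
          (ENNReal.ofReal (Real.exp κ) ^ n) ^ (1 / 2 : ℝ) := by gcongr
    _ = _ := by
        rw [ENNReal.mul_rpow_of_nonneg _ _ (by norm_num), hrt, hrt, mul_assoc, ← mul_pow,
          ← ENNReal.ofReal_mul (Real.exp_pos _).le, ← Real.exp_add]
        congr 4
        ring

theorem tsum_exp_pow_ne_top {κ : ℝ} (hκ : 0 < κ) :
    ∑' n : ℕ, ENNReal.ofReal (Real.exp (-κ)) ^ n ≠ ∞ := by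
  rw [ENNReal.tsum_geometric]
  refine ENNReal.inv_ne_top.2 (tsub_pos_of_lt ?_).ne'
  rw [ENNReal.ofReal_lt_one, Real.exp_lt_one_iff]
  linarith

theorem measurePreserving_infinitePi_fin (Q₀ : Measure X) [IsProbabilityMeasure Q₀] (n : ℕ) :
    MeasurePreserving (fun (x : ℕ → X) (i : Fin n) => x i)
      (Measure.infinitePi fun _ : ℕ => Q₀) (Measure.pi fun _ : Fin n => Q₀) := by
  refine ⟨by fun_prop, ?_⟩
  have := Measure.map_infinitePi_infinitePi_of_inj (P := fun _ : ℕ => Q₀)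
    (f := fun i : Fin n => (i : ℕ)) Fin.val_injective
  rw [← Measure.infinitePi_eq_pi]
  exact this

/-- The test compares the sample mean of g with the midpoint between its mean under Q₀ and the
threshold. By Borel–Cantelli the sample mean is eventually below the midpoint almost surely, and
there the posterior masses have summable expectations. -/
theorem ae_tendsto_posterior_integral_ge {π : Measure (ProbabilityMeasure X)}
    [IsProbabilityMeasure π] {Q₀ : Measure X} [IsProbabilityMeasure Q₀]
    (hπ : ChargesVicinity π Q₀) {post : ∀ n : ℕ, Kernel (Fin n → X) (ProbabilityMeasure X)}
    (hpost : ∀ n, IsPosterior π n (post n)) {g : X → ℝ} (hg : Measurable g) {M : ℝ}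
    (hM : ∀ x, |g x| ≤ M) {ε : ℝ} (hε : 0 < ε) :
    ∀ᵐ x ∂(Measure.infinitePi fun _ : ℕ => Q₀), Tendsto (fun n => post n (fun i => x i)
      {Q | ∫ y, g y ∂Q₀ + ε ≤ ∫ y, g y ∂(Q : Measure X)}) atTop (𝓝 0) := by
  set m := ∫ y, g y ∂Q₀
  set B : Set (ProbabilityMeasure X) := {Q | m + ε ≤ ∫ y, g y ∂(Q : Measure X)}
  have hB : MeasurableSet B := by
    let K : Kernel (ProbabilityMeasure X) X := ⟨fun Q => (Q : Measure X), measurable_subtype_coe⟩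
    have : IsMarkovKernel K := ⟨fun Q => inferInstanceAs (IsProbabilityMeasure (Q : Measure X))⟩
    have : StronglyMeasurable fun Q : ProbabilityMeasure X => ∫ y, g y ∂K Q :=
      StronglyMeasurable.integral_kernel hg.stronglyMeasurable
    exact measurableSet_le measurable_const this.measurable
  set D : (n : ℕ) → Set (Fin n → X) := fun n => {x | ∑ i, g (x i) ≤ n * (m + ε / 2)}
  have hD : ∀ n, MeasurableSet (D n) := fun n =>
    measurableSet_le (by fun_prop) measurable_const
  obtain ⟨κ, hκ, hch⟩ := exists_pi_sum_le_le hg hM (half_pos hε)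
  obtain ⟨κ', hκ', hch'⟩ := exists_pi_sum_le_le (g := fun x => -g x) hg.neg
    (fun x => by rw [abs_neg]; exact hM x) (half_pos hε)
  obtain ⟨c, hc, hint⟩ := hπ.exists_setLIntegral_le hκ
  have hmp := measurePreserving_infinitePi_fin Q₀
  have hD_ae : ∀ᵐ x ∂(Measure.infinitePi fun _ : ℕ => Q₀),
      ∀ᶠ n : ℕ in atTop, x ∉ (fun (x : ℕ → X) (i : Fin n) => x i) ⁻¹' (D n)ᶜ := by
    refine ae_eventually_notMem (ne_top_of_le_ne_top
      (tsum_exp_pow_ne_top (mul_pos four_pos hκ')) (ENNReal.tsum_le_tsum fun n => ?_))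
    rw [(hmp n).measure_preimage (hD n).compl.nullMeasurableSet]
    refine (measure_mono fun x hx => ?_).trans (hch' Q₀ (-(m + ε / 2)) ?_ n)
    · have hx' : ¬ ∑ i, g (x i) ≤ n * (m + ε / 2) := hx
      simp only [Set.mem_ofPred_eq, Finset.sum_neg_distrib]
      linarith
    · rw [integral_neg]
      linarith
  have hmeas : ∀ n, Measurable ((D n).indicator fun x => post n x B) := fun n =>
    (Kernel.measurable_coe (post n) hB).indicator (hD n)
  have hsum : ∀ᵐ x ∂(Measure.infinitePi fun _ : ℕ => Q₀),
      ∑' n : ℕ, (D n).indicator (fun x => post n x B) (fun i => x i) < ∞ := by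
    have hmeas' : ∀ n, Measurable fun x : ℕ → X =>
        (D n).indicator (fun x => post n x B) fun i => x i :=
      fun n => (hmeas n).comp (hmp n).measurable
    refine ae_lt_top (Measurable.tsum hmeas') ?_
    rw [lintegral_tsum fun n => (hmeas' n).aemeasurable]
    refine ne_top_of_le_ne_top (ENNReal.mul_ne_top hc (tsum_exp_pow_ne_top hκ)) ?_
    rw [← ENNReal.tsum_mul_left]
    refine ENNReal.tsum_le_tsum fun n => ?_
    rw [(hmp n).lintegral_comp (hmeas n), lintegral_indicator (hD n)]
    refine hint n (post n) (hpost n) (D n) B (hD n) hB fun Q hQ => hch (Q : Measure X) _ ?_ n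
    have : m + ε ≤ ∫ y, g y ∂(Q : Measure X) := hQ
    linarith
  filter_upwards [hD_ae, hsum] with x hx hxs
  refine (ENNReal.tendsto_atTop_zero_of_tsum_ne_top hxs.ne).congr' ?_
  filter_upwards [hx] with n hn
  exact Set.indicator_of_mem (not_not.1 hn) _

/-- **Schwartz's theorem**: posterior consistency in the weak topology. -/
theorem ae_tendsto_posterior_nhds [TopologicalSpace X] [PolishSpace X] [BorelSpace X]
    {π : Measure (ProbabilityMeasure X)} [IsProbabilityMeasure π] {Q₀ : ProbabilityMeasure X}
    (hπ : ChargesVicinity π (Q₀ : Measure X))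
    {post : ∀ n : ℕ, Kernel (Fin n → X) (ProbabilityMeasure X)}
    (hpost : ∀ n, IsPosterior π n (post n)) :
    ∀ᵐ x ∂(Measure.infinitePi fun _ : ℕ => (Q₀ : Measure X)),
      ∀ U ∈ 𝓝 Q₀, Tendsto (fun n => post n (fun i => x i) U) atTop (𝓝 1) := by
  -- The sets whose complements almost surely lose all posterior mass form a filter. Its convergence
  -- to Q₀ can therefore be tested on one bounded continuous function at a time.
  let 𝓖 : Filter (ProbabilityMeasure X) :=
    { sets := {U | ∀ᵐ x ∂(Measure.infinitePi fun _ : ℕ => (Q₀ : Measure X)),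
        Tendsto (fun n => post n (fun i => x i) Uᶜ) atTop (𝓝 0)}
      univ_sets := by simp
      sets_of_superset := fun {U V} hU hUV => by
        rw [Set.mem_ofPred_eq] at hU ⊢
        filter_upwards [hU] with x hx
        exact tendsto_of_tendsto_of_tendsto_of_le_of_le tendsto_const_nhds hx
          (fun _ => zero_le) fun n => measure_mono (Set.compl_subset_compl.2 hUV)
      inter_sets := fun {U V} hU hV => by
        rw [Set.mem_ofPred_eq] at hU hV ⊢
        filter_upwards [hU, hV] with x hxU hxV
        have := hxU.add hxV
        rw [add_zero] at this
        refine tendsto_of_tendsto_of_tendsto_of_le_of_le tendsto_const_nhds this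
          (fun _ => zero_le) fun n => ?_
        rw [Set.compl_inter]
        exact measure_union_le _ _ }
  have h𝓖 : Tendsto id 𝓖 (𝓝 Q₀) := by
    rw [ProbabilityMeasure.tendsto_iff_forall_integral_tendsto]
    intro g
    have hg : Measurable g := g.continuous.measurable
    rw [Metric.tendsto_nhds]
    intro ε hε
    have h1 := ae_tendsto_posterior_integral_ge hπ hpost hg (M := ‖g‖)
      (fun x => g.norm_coe_le_norm x) hε
    have h2 := ae_tendsto_posterior_integral_ge hπ hpost hg.neg (M := ‖g‖)
      (fun x => by rw [Pi.neg_apply, abs_neg]; exact g.norm_coe_le_norm x) hε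
    change ∀ᵐ x ∂(Measure.infinitePi fun _ : ℕ => (Q₀ : Measure X)), _
    filter_upwards [h1, h2] with x hx1 hx2
    have := hx1.add hx2
    rw [add_zero] at this
    refine tendsto_of_tendsto_of_tendsto_of_le_of_le tendsto_const_nhds this
      (fun _ => zero_le) fun n => (measure_mono fun Q hQ => ?_).trans (measure_union_le _ _)
    by_contra hcon
    simp only [Set.mem_union, Set.mem_ofPred_eq, not_or, not_le, Pi.neg_apply, integral_neg]
      at hcon
    refine hQ ?_
    simp only [Set.mem_ofPred_eq, id, Real.dist_eq, abs_lt]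
    constructor <;> linarith
  have hU : ∀ U ∈ 𝓝 Q₀, ∀ᵐ x ∂(Measure.infinitePi fun _ : ℕ => (Q₀ : Measure X)),
      Tendsto (fun n => post n (fun i => x i) Uᶜ) atTop (𝓝 0) := fun U hU => h𝓖 hU
  -- A countable basis of neighbourhoods yields one null set that serves all U.
  obtain ⟨b, hb⟩ := (𝓝 Q₀).exists_antitone_basis
  have hall : ∀ᵐ x ∂(Measure.infinitePi fun _ : ℕ => (Q₀ : Measure X)),
      ∀ k, Tendsto (fun n => post n (fun i => x i) (b k)ᶜ) atTop (𝓝 0) :=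
    ae_all_iff.2 fun k => hU _ (hb.1.mem_of_mem trivial)
  filter_upwards [hall] with x hx U hUx
  obtain ⟨k, -, hk⟩ := hb.1.mem_iff.1 hUx
  have hlim : Tendsto (fun n => 1 - post n (fun i => x i) (b k)ᶜ) atTop (𝓝 1) := by
    have := ENNReal.Tendsto.sub (tendsto_const_nhds (x := (1 : ℝ≥0∞)) (f := atTop)) (hx k)
      (Or.inl ENNReal.one_ne_top)
    rwa [tsub_zero] at this
  have hprob := fun n => (hpost n).1
  refine tendsto_of_tendsto_of_tendsto_of_le_of_le hlim tendsto_const_nhds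
    (fun n => ?_) fun n => prob_le_one
  -- Neither U nor the basic set need be measurable, so only subadditivity is used.
  rw [tsub_le_iff_right]
  calc 1 = post n (fun i => x i) Set.univ := measure_univ.symm
    _ ≤ post n (fun i => x i) (U ∪ (b k)ᶜ) := by
        refine measure_mono fun Q _ => ?_
        by_cases hQ : Q ∈ b k
        · exact Or.inl (hk hQ)
        · exact Or.inr hQ
    _ ≤ _ := measure_union_le _ _

end PosteriorConsistency

/-! ### Support of the Dirichlet distribution -/

section Dirichlet

theorem ae_pos_gammaMeasure {a r : ℝ} : ∀ᵐ x ∂gammaMeasure a r, 0 < x := by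
  rw [ae_iff]
  have : {x : ℝ | ¬ 0 < x} = Set.Iic 0 := by
    ext x
    simp
  rw [this, gammaMeasure, withDensity_apply _ measurableSet_Iic, setLIntegral_congr Iio_ae_eq_Iic.symm]
  exact lintegral_gammaPDF_of_nonpos le_rfl

theorem gammaMeasure_Ioo_pos {a r : ℝ} (ha : 0 < a) (hr : 0 < r) {x y : ℝ} (hx : 0 ≤ x)
    (hxy : x < y) : 0 < gammaMeasure a r (Set.Ioo x y) := by
  have hmeas : Measurable (gammaPDF a r) := (measurable_gammaPDFReal a r).ennreal_ofReal
  rw [gammaMeasure, withDensity_apply _ measurableSet_Ioo, setLIntegral_pos_iff hmeas]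
  have : Function.support (gammaPDF a r) ∩ Set.Ioo x y = Set.Ioo x y := by
    refine Set.inter_eq_right.2 fun z hz => ?_
    exact (ENNReal.ofReal_pos.2 (gammaPDFReal_pos ha hr (hx.trans_lt hz.1))).ne'
  rw [this, Real.volume_Ioo]
  simpa using hxy

theorem ae_sum_dirichlet {K : ℕ} (hK : 0 < K) {a : Fin K → ℝ} (ha : ∀ i, 0 < a i) :
    ∀ᵐ θ ∂dirichlet a, ∑ l, ENNReal.ofReal (θ l) = 1 := by
  have : ∀ i, IsProbabilityMeasure (gammaMeasure (a i) 1) := fun i =>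
    isProbabilityMeasure_gammaMeasure (ha i) one_pos
  have hms : MeasurableSet {θ : Fin K → ℝ | ∑ l, ENNReal.ofReal (θ l) = 1} :=
    measurableSet_eq_fun (by fun_prop) measurable_const
  have hf : Measurable fun (g : Fin K → ℝ) i => g i / ∑ l, g l := by fun_prop
  rw [dirichlet, ae_map_iff hf.aemeasurable hms]
  have hall : ∀ᵐ g ∂(Measure.pi fun i => gammaMeasure (a i) 1), ∀ i, 0 < g i :=
    ae_all_iff.2 fun i =>
      (measurePreserving_eval (fun i => gammaMeasure (a i) 1) i).quasiMeasurePreserving.ae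
        ae_pos_gammaMeasure
  filter_upwards [hall] with g hg
  have hs : 0 < ∑ l, g l := Finset.sum_pos (fun i _ => hg i) ⟨⟨0, hK⟩, Finset.mem_univ _⟩
  rw [← ENNReal.ofReal_sum_of_nonneg fun i _ => (div_pos (hg i) hs).le, ← Finset.sum_div,
    div_self hs.ne', ENNReal.ofReal_one]

/-- The Dirichlet distribution charges every neighbourhood of every interior point `p` of the
simplex. -/
theorem dirichlet_pos {K : ℕ} {a : Fin K → ℝ} (ha : ∀ i, 0 < a i) {p : Fin K → ℝ}
    (hp : ∀ i, 0 < p i) (hp1 : ∑ i, p i = 1) {s : ℝ} (hs : s < 1) :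
    0 < dirichlet a {θ | ∀ i, s * p i ≤ θ i} := by
  have : ∀ i, IsProbabilityMeasure (gammaMeasure (a i) 1) := fun i =>
    isProbabilityMeasure_gammaMeasure (ha i) one_pos
  have hms : MeasurableSet {θ : Fin K → ℝ | ∀ i, s * p i ≤ θ i} := by
    rw [Set.ofPred_forall]
    exact MeasurableSet.iInter fun i => measurableSet_le measurable_const (by fun_prop)
  have hf : Measurable fun (g : Fin K → ℝ) i => g i / ∑ l, g l := by fun_prop
  rw [dirichlet, Measure.map_apply hf hms]
  set s' := max s 0
  have hs' : s' < 1 := max_lt hs one_pos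
  have hs0 : 0 ≤ s' := le_max_right _ _
  refine lt_of_lt_of_le ?_ (measure_mono
    (s := Set.univ.pi fun i => Set.Ioo (s' * p i) (p i)) fun g hg => ?_)
  · rw [Measure.pi_pi]
    refine CanonicallyOrderedAdd.prod_pos.2 fun i _ => ?_
    refine gammaMeasure_Ioo_pos (ha i) one_pos (mul_nonneg hs0 (hp i).le) ?_
    exact mul_lt_of_lt_one_left (hp i) hs'
  · have hg' : ∀ i, g i ∈ Set.Ioo (s' * p i) (p i) := fun i => hg i (Set.mem_univ i)
    have hg0 : ∀ i, 0 < g i := fun i => (mul_nonneg hs0 (hp i).le).trans_lt (hg' i).1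
    intro i
    have hsum : 0 < ∑ l, g l := Finset.sum_pos (fun i _ => hg0 i) ⟨i, Finset.mem_univ _⟩
    have hsum1 : ∑ l, g l ≤ 1 := hp1 ▸ Finset.sum_le_sum fun l _ => (hg' l).2.le
    calc s * p i ≤ s' * p i := mul_le_mul_of_nonneg_right (le_max_left _ _) (hp i).le
      _ ≤ g i := (hg' i).1.le
      _ ≤ g i / ∑ l, g l := le_div_self (hg0 i).le hsum hsum1

end Dirichlet

/-! ### Recursions along the tree and conservation of mass -/

section Tree

variable {X : Type*} [MeasurableSpace X] {μ : Measure X} {N : Type*} (T : PartitionScheme μ N)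

namespace PartitionScheme

theorem region_nonempty (A : N) : (T.region A).Nonempty :=
  nonempty_of_measure_ne_zero (T.measure_region_pos A).ne'

theorem region_child_subset (A : N) (j : Fin (T.numWays A)) (l : Fin (T.numParts A j)) :
    T.region (T.child A j l) ⊆ T.region A := by
  rw [← T.iUnion_child A j]
  exact Set.subset_iUnion (fun l => T.region (T.child A j l)) l

theorem numParts_pos (A : N) (j : Fin (T.numWays A)) : 0 < T.numParts A j := by
  obtain ⟨x, hx⟩ := T.region_nonempty A
  rw [← T.iUnion_child A j] at hx
  obtain ⟨l, -⟩ := Set.mem_iUnion.1 hx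
  exact l.pos

/-- The mass that is stopped after exactly `k` steps. -/
def haltMeasure (T : PartitionScheme μ N) (ω : (A : N) → T.Draw A) : ℕ → N → Measure X
  | 0, A =>
    match (ω A).1 with
    | Decision.halt => μ[|T.region A]
    | Decision.split _ => 0
  | k + 1, A =>
    match (ω A).1 with
    | Decision.halt => 0
    | Decision.split j =>
      ∑ l, ENNReal.ofReal ((ω A).2 j l) • T.haltMeasure ω k (T.child A j l)

/-- A quantity that starts from `init`, is averaged over the parts when a region is divided, and
is set to `leaf` when a region is stopped. -/
def fold (T : PartitionScheme μ N) (init leaf : N → ℝ≥0∞) (ω : (A : N) → T.Draw A) : ℕ → N → ℝ≥0∞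
  | 0, A => init A
  | k + 1, A =>
    match (ω A).1 with
    | Decision.halt => leaf A
    | Decision.split j =>
      ∑ l, ENNReal.ofReal ((ω A).2 j l) * T.fold init leaf ω k (T.child A j l)

/-- The mass that is not stopped within `k` steps. -/
def activeMass (ω : (A : N) → T.Draw A) (k : ℕ) (A : N) : ℝ≥0∞ :=
  T.fold (fun _ => 1) (fun _ => 0) ω k A

theorem stage_apply_eq_fold (ω : (A : N) → T.Draw A) (s : Set X) (k : ℕ) (A : N) :
    T.stage ω k A s =
      T.fold (fun A => μ[|T.region A] s) (fun A => μ[|T.region A] s) ω k A := by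
  induction k generalizing A with
  | zero => rfl
  | succ k ih =>
    rw [stage, fold]
    cases (ω A).1 with
    | halt => rfl
    | split j => simp [Measure.finsetSum_apply, ih]

theorem sum_haltMeasure_le_stage (ω : (A : N) → T.Draw A) (k : ℕ) (A : N) :
    ∑ i ∈ Finset.range k, T.haltMeasure ω i A ≤ T.stage ω k A := by
  induction k generalizing A with
  | zero => exact Measure.zero_le _
  | succ k ih =>
    rw [Finset.sum_range_succ']
    simp only [stage, haltMeasure]
    cases (ω A).1 with
    | halt => simp
    | split j =>
      simp only [add_zero]
      rw [Finset.sum_comm]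
      refine Finset.sum_le_sum fun l _ => ?_
      rw [← Finset.smul_sum]
      gcongr
      exact ih _

/-- Only draws at subregions of A enter the recursion. The σ-algebra is arbitrary so that the result
serves independence arguments as well as plain measurability. -/
theorem measurable_fold (init leaf : N → ℝ≥0∞) (k : ℕ) (A : N)
    {m : MeasurableSpace ((A : N) → T.Draw A)}
    (hm : ∀ B, T.region B ⊆ T.region A → Measurable[m] fun ω : (A : N) → T.Draw A => ω B) :
    Measurable[m] fun ω => T.fold init leaf ω k A := by
  induction k generalizing A with
  | zero => exact measurable_const
  | succ k ih =>
    have hA : Measurable[m] fun ω : (A : N) → T.Draw A => ω A := hm A subset_rfl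
    -- The case distinction on the discrete decision is rewritten as a finite sum of functions of
    -- the decision times measurable terms.
    let φ : Decision (T.numWays A) → ℝ≥0∞ := fun d => match d with
      | Decision.halt => leaf A
      | Decision.split _ => 0
    let ψ : Fin (T.numWays A) → Decision (T.numWays A) → ℝ≥0∞ := fun j d => match d with
      | Decision.halt => 0
      | Decision.split i => if i = j then 1 else 0
    have key : (fun ω => T.fold init leaf ω (k + 1) A) =
        fun ω => φ (ω A).1 + ∑ j, ψ j (ω A).1 * ∑ l, ENNReal.ofReal ((ω A).2 j l) * T.fold init leaf ω k (T.child A j l) := by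
      funext ω
      rw [fold]
      cases (ω A).1 with
      | halt => simp [φ, ψ]
      | split j => simp [φ, ψ]
    rw [key]
    have hd : Measurable[m] fun ω : (A : N) → T.Draw A => (ω A).1 := measurable_fst.comp hA
    have hdec : ∀ φ : Decision (T.numWays A) → ℝ≥0∞,
        Measurable[m] fun ω : (A : N) → T.Draw A => φ (ω A).1 :=
      fun φ => (measurable_from_top (f := φ)).comp hd
    refine Measurable.add (hdec φ) ?_
    refine Finset.measurable_sum _ fun j _ => Measurable.mul (hdec (ψ j)) ?_
    refine Finset.measurable_sum _ fun l _ => Measurable.mul ?_ ?_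
    · exact (((measurable_pi_apply l).comp ((measurable_pi_apply j).comp measurable_snd)).comp
        hA).ennreal_ofReal
    · exact ih _ fun B hB => hm B (hB.trans (T.region_child_subset A j l))

end PartitionScheme

variable {T} (P : Params T)

instance : IsProbabilityMeasure P.treeLaw := by
  unfold Params.treeLaw
  infer_instance

theorem Params.measurePreserving_eval_treeLaw (A : N) :
    MeasurePreserving (fun ω : (A : N) → T.Draw A => ω A) P.treeLaw
      ((decisionLaw (P.rho A) (P.lam A)).prod (Measure.pi fun j => dirichlet (P.alpha A j))) :=
  measurePreserving_eval_infinitePi _ A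

theorem Params.ae_sum_weights (A : N) :
    ∀ᵐ ω ∂P.treeLaw, ∀ j, ∑ l, ENNReal.ofReal ((ω A).2 j l) = 1 := by
  have h1 := isProbabilityMeasure_decisionLaw (P.rho_nonneg A) (P.rho_le_one A) (P.lam_nonneg A)
    (P.sum_lam A)
  have h2 := fun j => isProbabilityMeasure_dirichlet (P.alpha_pos A j)
  refine (P.measurePreserving_eval_treeLaw A).quasiMeasurePreserving.ae
    (p := fun d : T.Draw A => ∀ j, ∑ l, ENNReal.ofReal (d.2 j l) = 1) ?_
  refine Measure.quasiMeasurePreserving_snd.ae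
    (p := fun θ : (j : Fin (T.numWays A)) → Fin (T.numParts A j) → ℝ =>
      ∀ j, ∑ l, ENNReal.ofReal (θ j l) = 1) ?_
  exact ae_all_iff.2 fun j =>
    (measurePreserving_eval (fun j => dirichlet (P.alpha A j)) j).quasiMeasurePreserving.ae
      (ae_sum_dirichlet (T.numParts_pos A j) (P.alpha_pos A j))

theorem Params.ae_fold_eq_one (k : ℕ) (A : N) :
    ∀ᵐ ω ∂P.treeLaw, T.fold (fun _ => 1) (fun _ => 1) ω k A = 1 := by
  induction k generalizing A with
  | zero => exact ae_of_all _ fun _ => rfl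
  | succ k ih =>
    have hch : ∀ᵐ ω ∂P.treeLaw, ∀ j l,
        T.fold (fun _ => 1) (fun _ => 1) ω k (T.child A j l) = 1 :=
      ae_all_iff.2 fun j => ae_all_iff.2 fun l => ih _
    filter_upwards [hch, P.ae_sum_weights A] with ω h1 h2
    rw [PartitionScheme.fold]
    cases (ω A).1 with
    | halt => rfl
    | split j => simp [h1, h2]

variable [IsFiniteMeasure μ]

theorem PartitionScheme.isProbabilityMeasure_cond_region (T : PartitionScheme μ N) (A : N) :
    IsProbabilityMeasure μ[|T.region A] :=
  cond_isProbabilityMeasure (T.measure_region_pos A).ne'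

theorem Params.ae_stage_univ (k : ℕ) (A : N) :
    ∀ᵐ ω ∂P.treeLaw, T.stage ω k A Set.univ = 1 := by
  have := fun A => T.isProbabilityMeasure_cond_region A
  filter_upwards [P.ae_fold_eq_one k A] with ω h
  simpa [T.stage_apply_eq_fold] using h

theorem Params.ae_activeMass_add (k : ℕ) (A : N) :
    ∀ᵐ ω ∂P.treeLaw, T.activeMass ω k A +
      ∑ i ∈ Finset.range k, T.haltMeasure ω i A Set.univ = 1 := by
  have := fun A => T.isProbabilityMeasure_cond_region A
  induction k generalizing A with
  | zero => exact ae_of_all _ fun _ => by simp [PartitionScheme.activeMass, PartitionScheme.fold]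
  | succ k ih =>
    have hch : ∀ᵐ ω ∂P.treeLaw, ∀ j l, T.activeMass ω k (T.child A j l) +
        ∑ i ∈ Finset.range k, T.haltMeasure ω i (T.child A j l) Set.univ = 1 :=
      ae_all_iff.2 fun j => ae_all_iff.2 fun l => ih _
    filter_upwards [hch, P.ae_sum_weights A] with ω h1 h2
    rw [Finset.sum_range_succ', PartitionScheme.activeMass]
    simp only [PartitionScheme.fold, PartitionScheme.haltMeasure]
    cases (ω A).1 with
    | halt => simp
    | split j =>
      simp only [Measure.finsetSum_apply, Measure.smul_apply, smul_eq_mul, Measure.coe_zero,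
        Pi.zero_apply, add_zero]
      rw [Finset.sum_comm, ← Finset.sum_add_distrib]
      refine Eq.trans ?_ (h2 j)
      refine Finset.sum_congr rfl fun l _ => ?_
      rw [← Finset.mul_sum, ← mul_add]
      exact (congrArg _ (h1 j l)).trans (mul_one _)

end Tree

/-! ### Existence and measurability of the limiting random measure -/

section Convergence

variable {X : Type*} [MeasurableSpace X] {μ : Measure X} {N : Type*} {T : PartitionScheme μ N}

/-- A part that filled A would be the only one, since the others are disjoint from it and nonempty;
its mean weight would then be 1 > 1 - δ. Hence the label A does not recur below its parts, and the
draw at A is independent of the draws there. -/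
theorem Params.UniformlyBounded.not_region_subset_child {P : Params T} (hP : P.UniformlyBounded)
    (A : N) (j : Fin (T.numWays A)) (l : Fin (T.numParts A j)) :
    ¬ T.region A ⊆ T.region (T.child A j l) := by
  intro hsub
  obtain ⟨δ, hδ, h⟩ := hP
  have hl := (((h A).2 j).2 l).2
  by_cases hex : ∃ l', l' ≠ l
  · obtain ⟨l', hl'⟩ := hex
    obtain ⟨x, hx⟩ := T.region_nonempty (T.child A j l')
    exact Set.disjoint_left.1 (T.disjoint_child A j hl') hx
      (hsub (T.region_child_subset A j l' hx))
  · push Not at hex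
    have hsum : ∑ i, P.alpha A j i = P.alpha A j l :=
      Finset.sum_eq_single l (fun i _ hi => absurd (hex i) hi)
        fun hi => absurd (Finset.mem_univ _) hi
    rw [hsum, div_self (P.alpha_pos A j l).ne'] at hl
    linarith

theorem decisionLaw_halt_pos {M : ℕ} {r : ℝ} {p : Fin M → ℝ} (hr : M ≠ 0 → 0 < r) :
    0 < decisionLaw r p {Decision.halt} := by
  unfold decisionLaw
  split_ifs with h
  · simp
  · simp only [Measure.add_apply, Measure.smul_apply, smul_eq_mul]
    refine add_pos_of_pos_of_nonneg ?_ zero_le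
    simpa using hr h

theorem decisionLaw_split_pos {M : ℕ} {r : ℝ} {p : Fin M → ℝ} (hr : r < 1) {j : Fin M}
    (hj : 0 < p j) : 0 < decisionLaw r p {Decision.split j} := by
  have hM : M ≠ 0 := by
    rintro rfl
    exact j.elim0
  unfold decisionLaw
  rw [if_neg hM]
  simp only [Measure.add_apply, Measure.smul_apply, smul_eq_mul, Measure.finsetSum_apply]
  refine lt_of_lt_of_le ?_ le_add_self
  refine lt_of_lt_of_le ?_ (Finset.single_le_sum (f := fun i => ENNReal.ofReal ((1 - r) * p i) *
    Measure.dirac (Decision.split i) {Decision.split j}) (fun i _ => zero_le) (Finset.mem_univ j))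
  simpa using mul_pos (sub_pos.2 hr) hj

theorem decisionLaw_compl_halt_le {M : ℕ} {r δ : ℝ} {p : Fin M → ℝ}
    [IsProbabilityMeasure (decisionLaw r p)] (hr : M ≠ 0 → δ ≤ r) :
    decisionLaw r p {Decision.halt}ᶜ ≤ ENNReal.ofReal (1 - δ) := by
  by_cases hM : M = 0
  · unfold decisionLaw
    rw [if_pos hM]
    simp
  · rw [prob_compl_eq_one_sub MeasurableSpace.measurableSet_top, tsub_le_iff_right]
    have h1 : ENNReal.ofReal δ ≤ decisionLaw r p {Decision.halt} := by
      unfold decisionLaw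
      rw [if_neg hM]
      simp only [Measure.add_apply, Measure.smul_apply, smul_eq_mul]
      refine le_add_of_le_of_nonneg ?_ zero_le
      simpa using ENNReal.ofReal_le_ofReal (hr hM)
    calc (1 : ℝ≥0∞) = ENNReal.ofReal (1 - δ + δ) := by simp
      _ ≤ ENNReal.ofReal (1 - δ) + ENNReal.ofReal δ := ENNReal.ofReal_add_le
      _ ≤ _ := by gcongr

variable (P : Params T)

theorem Params.indep_treeLaw {S S' : Set N} (h : Disjoint S S') :
    Indep (⨆ B ∈ S, MeasurableSpace.comap (fun ω : (A : N) → T.Draw A => ω B) inferInstance)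
      (⨆ B ∈ S', MeasurableSpace.comap (fun ω : (A : N) → T.Draw A => ω B) inferInstance)
      P.treeLaw := by
  have hind : iIndepFun (fun (A : N) (ω : (A : N) → T.Draw A) => ω A) P.treeLaw :=
    iIndepFun_infinitePi (X := fun A (d : T.Draw A) => d) fun A => measurable_id
  exact indep_iSup_of_disjoint (fun A => (measurable_pi_apply A).comap_le) hind h

/-- A region survives a step with probability at most 1 - δ, independently of what happens below it,
and the weights sum to 1. Linearity of expectation suffices: sibling parts need not be independent.
-/
theorem Params.lintegral_activeMass_le (hT : ∀ A j l, ¬ T.region A ⊆ T.region (T.child A j l))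
    {δ : ℝ} (hδ : ∀ A, T.numWays A ≠ 0 → δ ≤ P.rho A) (k : ℕ) (A : N) :
    ∫⁻ ω, T.activeMass ω k A ∂P.treeLaw ≤ ENNReal.ofReal (1 - δ) ^ k := by
  have := fun A => isProbabilityMeasure_decisionLaw (P.rho_nonneg A) (P.rho_le_one A)
    (P.lam_nonneg A) (P.sum_lam A)
  have := fun A j => isProbabilityMeasure_dirichlet (P.alpha_pos A j)
  induction k generalizing A with
  | zero => simp [PartitionScheme.activeMass, PartitionScheme.fold]
  | succ k ih =>
    let ψ : Fin (T.numWays A) → Decision (T.numWays A) → ℝ≥0∞ := fun j d => match d with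
      | Decision.halt => 0
      | Decision.split i => if i = j then 1 else 0
    have key : ∀ ω, T.activeMass ω (k + 1) A = ∑ j, ∑ l,
        (ψ j (ω A).1 * ENNReal.ofReal ((ω A).2 j l)) * T.activeMass ω k (T.child A j l) := by
      intro ω
      simp only [PartitionScheme.activeMass, PartitionScheme.fold, mul_assoc, ← Finset.mul_sum]
      cases (ω A).1 with
      | halt => simp [ψ]
      | split j => simp [ψ]
    have hwm : ∀ j l, Measurable fun d : T.Draw A => ψ j d.1 * ENNReal.ofReal (d.2 j l) := by
      intro j l
      refine Measurable.mul ((measurable_from_top (f := ψ j)).comp measurable_fst) ?_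
      exact ((measurable_pi_apply l).comp
        ((measurable_pi_apply j).comp measurable_snd)).ennreal_ofReal
    have hwm' : ∀ j l, Measurable fun ω : (A : N) → T.Draw A =>
        ψ j (ω A).1 * ENNReal.ofReal ((ω A).2 j l) :=
      fun j l => (hwm j l).comp (measurable_pi_apply A)
    have ham : ∀ B, Measurable fun ω : (A : N) → T.Draw A => T.activeMass ω k B :=
      fun B => T.measurable_fold _ _ k B fun C _ => measurable_pi_apply C
    have hmul : ∀ j l, ∫⁻ ω, (ψ j (ω A).1 * ENNReal.ofReal ((ω A).2 j l)) *
        T.activeMass ω k (T.child A j l) ∂P.treeLaw =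
        (∫⁻ ω, ψ j (ω A).1 * ENNReal.ofReal ((ω A).2 j l) ∂P.treeLaw) *
          ∫⁻ ω, T.activeMass ω k (T.child A j l) ∂P.treeLaw := by
      intro j l
      have hdisj : Disjoint ({A} : Set N) {B | T.region B ⊆ T.region (T.child A j l)} :=
        Set.disjoint_singleton_left.2 (hT A j l)
      refine lintegral_mul_eq_lintegral_mul_lintegral_of_independent_measurableSpace
        (iSup₂_le fun B _ => (measurable_pi_apply B).comap_le)
        (iSup₂_le fun B _ => (measurable_pi_apply B).comap_le) (P.indep_treeLaw hdisj) ?_ ?_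
      · exact (hwm j l).comp (measurable_iff_comap_le.2 (le_iSup₂_of_le A rfl le_rfl))
      · exact T.measurable_fold _ _ k _ fun B hB =>
          measurable_iff_comap_le.2 (le_iSup₂_of_le B hB le_rfl)
    calc ∫⁻ ω, T.activeMass ω (k + 1) A ∂P.treeLaw
        = ∑ j, ∑ l, (∫⁻ ω, ψ j (ω A).1 * ENNReal.ofReal ((ω A).2 j l) ∂P.treeLaw) *
          ∫⁻ ω, T.activeMass ω k (T.child A j l) ∂P.treeLaw := by
          simp only [key, ← hmul]
          have hm : ∀ j l, Measurable fun ω : (A : N) → T.Draw A =>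
              ψ j (ω A).1 * ENNReal.ofReal ((ω A).2 j l) * T.activeMass ω k (T.child A j l) :=
            fun j l => (hwm' j l).mul (ham _)
          rw [lintegral_finsetSum _ fun j _ => Finset.measurable_sum _ fun l _ => hm j l]
          exact Finset.sum_congr rfl fun j _ => lintegral_finsetSum _ fun l _ => hm j l
      _ ≤ ∑ j, ∑ l, (∫⁻ ω, ψ j (ω A).1 * ENNReal.ofReal ((ω A).2 j l) ∂P.treeLaw) *
          ENNReal.ofReal (1 - δ) ^ k := by
          gcongr
          exact ih _
      _ = (∫⁻ ω, ∑ j, ∑ l, ψ j (ω A).1 * ENNReal.ofReal ((ω A).2 j l) ∂P.treeLaw) *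
          ENNReal.ofReal (1 - δ) ^ k := by
          rw [lintegral_finsetSum _ fun j _ => Finset.measurable_sum _ fun l _ => hwm' j l,
            Finset.sum_mul]
          refine Finset.sum_congr rfl fun j _ => ?_
          rw [lintegral_finsetSum _ fun l _ => hwm' j l, Finset.sum_mul]
      _ ≤ (∫⁻ ω, ((fun ω : (A : N) → T.Draw A => ω A) ⁻¹' (Prod.fst ⁻¹' {Decision.halt}ᶜ)).indicator
            1 ω ∂P.treeLaw) * ENNReal.ofReal (1 - δ) ^ k := by
          refine mul_le_mul_left (lintegral_mono_ae ?_) _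
          filter_upwards [P.ae_sum_weights A] with ω hω
          simp only [← Finset.mul_sum, hω, mul_one]
          rcases hd : (ω A).1 with _ | i
          · simp [ψ]
          · simp [ψ, Set.indicator, hd]
      _ ≤ ENNReal.ofReal (1 - δ) * ENNReal.ofReal (1 - δ) ^ k := by
          have hms : MeasurableSet (Prod.fst ⁻¹' {Decision.halt}ᶜ : Set (T.Draw A)) :=
            measurable_fst (MeasurableSpace.measurableSet_top (s := {Decision.halt}ᶜ))
          rw [lintegral_indicator_one (measurable_pi_apply A hms),
            (P.measurePreserving_eval_treeLaw A).measure_preimage hms.nullMeasurableSet]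
          refine mul_le_mul_left ?_ _
          rw [measurePreserving_fst.measure_preimage
            (MeasurableSpace.measurableSet_top (s := {Decision.halt}ᶜ)).nullMeasurableSet]
          exact decisionLaw_compl_halt_le (hδ A)
      _ = _ := (pow_succ' _ _).symm

theorem Params.ae_tendsto_activeMass
    (hT : ∀ A j l, ¬ T.region A ⊆ T.region (T.child A j l)) {δ : ℝ} (hδ0 : 0 < δ)
    (hδ : ∀ A, T.numWays A ≠ 0 → δ ≤ P.rho A) (A : N) :
    ∀ᵐ ω ∂P.treeLaw, Tendsto (fun k => T.activeMass ω k A) atTop (𝓝 0) := by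
  have ham : ∀ k, Measurable fun ω : (A : N) → T.Draw A => T.activeMass ω k A :=
    fun k => T.measurable_fold _ _ k A fun C _ => measurable_pi_apply C
  have hsum : ∀ᵐ ω ∂P.treeLaw, ∑' k, T.activeMass ω k A < ∞ := by
    refine ae_lt_top (Measurable.tsum ham) ?_
    rw [lintegral_tsum fun k => (ham k).aemeasurable]
    refine ne_top_of_le_ne_top ?_
      (ENNReal.tsum_le_tsum fun k => P.lintegral_activeMass_le hT hδ k A)
    rw [ENNReal.tsum_geometric]
    refine ENNReal.inv_ne_top.2 (tsub_pos_of_lt ?_).ne'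
    rw [ENNReal.ofReal_lt_one]
    linarith
  filter_upwards [hsum] with ω hω
  exact ENNReal.tendsto_atTop_zero_of_tsum_ne_top hω.ne

/-- The excess of Q over S has total mass u, so it contributes at most u to any set. Adding the mass
of the complement to both sides avoids subtracting measures. -/
theorem apply_le_add_of_le {S Q : Measure X} {u : ℝ≥0∞} (hSQ : S ≤ Q) (hQ : Q Set.univ = 1)
    (hS : u + S Set.univ = 1) {B : Set X} (hB : MeasurableSet B) : Q B ≤ S B + u := by
  have hQB : Q Bᶜ ≠ ∞ :=
    ne_top_of_le_ne_top (hQ ▸ ENNReal.one_ne_top) (measure_mono (Set.subset_univ _))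
  have h1 : Q B + Q Bᶜ = 1 := by rw [measure_add_measure_compl hB, hQ]
  have h2 : S B + S Bᶜ = S Set.univ := measure_add_measure_compl hB
  refine (ENNReal.add_le_add_iff_right hQB).1 ?_
  rw [h1, ← hS, ← h2]
  calc u + (S B + S Bᶜ) = S B + u + S Bᶜ := by ring
    _ ≤ S B + u + Q Bᶜ := by gcongr

theorem abs_measureReal_sub_le {S P Q : Measure X} {u : ℝ≥0∞} (hSP : S ≤ P) (hSQ : S ≤ Q)
    (hP : P Set.univ = 1) (hQ : Q Set.univ = 1) (hS : u + S Set.univ = 1) {B : Set X}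
    (hB : MeasurableSet B) : |P.real B - Q.real B| ≤ u.toReal := by
  have hu : u ≠ ∞ := ne_top_of_le_ne_top ENNReal.one_ne_top (hS ▸ le_self_add)
  have hfin : ∀ R : Measure X, R Set.univ = 1 → R B ≠ ∞ := fun R hR =>
    ne_top_of_le_ne_top (hR ▸ ENNReal.one_ne_top) (measure_mono (Set.subset_univ _))
  have key : ∀ R R' : Measure X, S ≤ R → S ≤ R' → R Set.univ = 1 → R' Set.univ = 1 →
      R.real B ≤ R'.real B + u.toReal := fun R R' h h' hR hR' => by
    rw [measureReal_def, measureReal_def, ← ENNReal.toReal_add (hfin R' hR') hu]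
    refine ENNReal.toReal_mono (ENNReal.add_ne_top.2 ⟨hfin R' hR', hu⟩) ?_
    refine (apply_le_add_of_le h hR hS hB).trans ?_
    gcongr
  rw [abs_le]
  have h1 := key P Q hSP hSQ hP hQ
  have h2 := key Q P hSQ hSP hQ hP
  constructor <;> linarith

/-- The limit is the sum of all halted masses. It and the k-th stage are probability measures that
both dominate the mass halted within k steps, so on every measurable set they differ by at most the
active mass. -/
theorem exists_tendstoVariation {ω : (A : N) → T.Draw A} {A : N}
    (hstage : ∀ k, T.stage ω k A Set.univ = 1)
    (hadd : ∀ k, T.activeMass ω k A +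
      ∑ i ∈ Finset.range k, T.haltMeasure ω i A Set.univ = 1)
    (hlim : Tendsto (fun k => T.activeMass ω k A) atTop (𝓝 0)) :
    ∃ Q : ProbabilityMeasure X, TendstoVariation (fun k => T.stage ω k A) (Q : Measure X) := by
  set Q : Measure X := Measure.sum fun i => T.haltMeasure ω i A
  have hQ : Q Set.univ = 1 := by
    rw [Measure.sum_apply _ MeasurableSet.univ]
    refine tendsto_nhds_unique ENNReal.summable.hasSum.tendsto_sum_nat ?_
    have h1 : ∀ k, ∑ i ∈ Finset.range k, T.haltMeasure ω i A Set.univ =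
        1 - T.activeMass ω k A := fun k => by
      refine ENNReal.eq_sub_of_add_eq ?_ (by rw [add_comm, hadd k])
      exact ne_top_of_le_ne_top ENNReal.one_ne_top (hadd k ▸ le_self_add)
    simp only [h1]
    have := ENNReal.Tendsto.sub (tendsto_const_nhds (x := (1 : ℝ≥0∞)) (f := atTop)) hlim
      (Or.inl ENNReal.one_ne_top)
    rwa [tsub_zero] at this
  have hSQ : ∀ k, ∑ i ∈ Finset.range k, T.haltMeasure ω i A ≤ Q := fun k => by
    refine Measure.le_iff.2 fun s hs => ?_
    rw [Measure.sum_apply _ hs, Measure.finsetSum_apply]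
    exact ENNReal.sum_le_tsum _
  refine ⟨⟨Q, ⟨hQ⟩⟩, ?_⟩
  rw [TendstoVariation, Metric.tendstoUniformlyOn_iff]
  intro ε hε
  have hu : Tendsto (fun k => (T.activeMass ω k A).toReal) atTop (𝓝 0) := by
    exact (ENNReal.tendsto_toReal ENNReal.zero_ne_top).comp hlim
  filter_upwards [hu.eventually_lt_const hε] with k hk B hB
  rw [Real.dist_eq]
  refine (abs_measureReal_sub_le (hSQ k) (T.sum_haltMeasure_le_stage ω k A) hQ (hstage k)
    ?_ hB).trans_lt hk
  rw [Measure.finsetSum_apply]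
  exact hadd k

variable [IsFiniteMeasure μ]

theorem Params.UniformlyBounded.ae_tendstoVariation {P : Params T} (hP : P.UniformlyBounded) :
    ∀ᵐ ω ∂P.treeLaw, TendstoVariation (fun k => T.stage ω k T.root)
      (T.limitMeasure ω : Measure X) := by
  have hT := hP.not_region_subset_child
  obtain ⟨δ, hδ, h⟩ := hP
  filter_upwards [ae_all_iff.2 fun k => P.ae_stage_univ k T.root,
    ae_all_iff.2 fun k => P.ae_activeMass_add k T.root,
    P.ae_tendsto_activeMass hT hδ (fun A hA => ((h A).1 hA).1.le) T.root] with ω h1 h2 h3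
  have hex := exists_tendstoVariation h1 h2 h3
  rw [PartitionScheme.limitMeasure, dif_pos hex]
  exact hex.choose_spec

theorem Params.UniformlyBounded.ae_tendsto_stage_apply {P : Params T}
    (hP : P.UniformlyBounded) : ∀ᵐ ω ∂P.treeLaw, ∀ B, MeasurableSet B →
      Tendsto (fun k => T.stage ω k T.root B) atTop (𝓝 ((T.limitMeasure ω : Measure X) B)) := by
  filter_upwards [hP.ae_tendstoVariation, ae_all_iff.2 fun k => P.ae_stage_univ k T.root]
    with ω h h1 B hB
  have := ENNReal.tendsto_ofReal (h.tendsto_at hB)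
  have hfin : ∀ k, T.stage ω k T.root B ≠ ∞ := fun k =>
    ne_top_of_le_ne_top (h1 k ▸ ENNReal.one_ne_top) (measure_mono (Set.subset_univ _))
  simpa [measureReal_def, ENNReal.ofReal_toReal, hfin] using this

/-- The limit is defined by choice. On a measurable set of full measure it is nevertheless the
setwise limit of the measurable stages; elsewhere it is replaced by the uniform law. -/
theorem Params.UniformlyBounded.aemeasurable_limitMeasure {P : Params T}
    (hP : P.UniformlyBounded) : AEMeasurable T.limitMeasure P.treeLaw := by
  obtain ⟨t, htm, ht, hlim⟩ : ∃ t : Set ((A : N) → T.Draw A), MeasurableSet t ∧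
      P.treeLaw tᶜ = 0 ∧ ∀ ω ∈ t, ∀ B, MeasurableSet B →
      Tendsto (fun k => T.stage ω k T.root B) atTop
        (𝓝 ((T.limitMeasure ω : Measure X) B)) := by
    obtain ⟨t, ht, htm, ht0⟩ := exists_measurable_superset_of_null
      (ae_iff.1 hP.ae_tendsto_stage_apply)
    refine ⟨tᶜ, htm.compl, by rwa [compl_compl], fun ω hω => ?_⟩
    by_contra hcon
    exact hω (ht hcon)
  classical
  refine ⟨t.piecewise T.limitMeasure fun _ => T.uniform, ?_, ?_⟩
  · have hst : ∀ B k, Measurable fun ω : (A : N) → T.Draw A => T.stage ω k T.root B := by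
      intro B k
      simp only [T.stage_apply_eq_fold]
      exact T.measurable_fold _ _ k _ fun C _ => measurable_pi_apply C
    have happ : ∀ B, MeasurableSet B → Measurable fun ω =>
        ((t.piecewise T.limitMeasure fun _ => T.uniform) ω : Measure X) B := by
      intro B hB
      refine measurable_of_tendsto_metrizable
        (f := fun k => t.piecewise (fun ω => T.stage ω k T.root B)
          fun _ => (T.uniform : Measure X) B)
        (fun k => (hst B k).piecewise htm measurable_const) ?_
      rw [tendsto_pi_nhds]
      intro ω
      by_cases hω : ω ∈ t
      · simp only [Set.piecewise_eq_of_mem _ _ _ hω]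
        exact hlim ω hω B hB
      · simp only [Set.piecewise_eq_of_notMem _ _ _ hω]
        exact tendsto_const_nhds
    exact Measurable.subtype_mk (Measure.measurable_of_measurable_coe _ happ)
  · have : ∀ᵐ ω ∂P.treeLaw, ω ∈ t := ht
    filter_upwards [this] with ω hω
    exact (Set.piecewise_eq_of_mem _ _ _ hω).symm

theorem Params.UniformlyBounded.isProbabilityMeasure_prior {P : Params T}
    (hP : P.UniformlyBounded) : IsProbabilityMeasure P.prior :=
  Measure.isProbabilityMeasure_map hP.aemeasurable_limitMeasure

end Convergence

/-! ### Positive prior probability of dominating a given step density -/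

section Support

variable {X : Type*} [MeasurableSpace X] {μ : Measure X} {N : Type*} {T : PartitionScheme μ N}

theorem PartitionScheme.RecPartition.exists_region_eq {A : N} (R : T.RecPartition A) {L : Set X}
    (hL : L ∈ R.parts) : ∃ B, L = T.region B ∧ T.region B ⊆ T.region A := by
  induction R with
  | halt A => exact ⟨A, hL, subset_rfl⟩
  | split A j sub ih =>
    obtain ⟨l, hl⟩ := Set.mem_iUnion.1 hL
    obtain ⟨B, rfl, hB⟩ := ih l hl
    exact ⟨B, rfl, hB.trans (T.region_child_subset A j l)⟩

theorem PartitionScheme.RecPartition.finite_parts {A : N} (R : T.RecPartition A) :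
    R.parts.Finite := by
  induction R with
  | halt A => exact Set.finite_singleton _
  | split A j sub ih => exact Set.finite_iUnion ih

theorem PartitionScheme.RecPartition.disjoint_parts {A : N} (R : T.RecPartition A) {L L' : Set X}
    (hL : L ∈ R.parts) (hL' : L' ∈ R.parts) (hne : L ≠ L') : Disjoint L L' := by
  induction R with
  | halt A => exact absurd (Eq.trans hL (Eq.symm hL')) hne
  | split A j sub ih =>
    obtain ⟨l, hl⟩ := Set.mem_iUnion.1 hL
    obtain ⟨l', hl'⟩ := Set.mem_iUnion.1 hL'
    by_cases h : l = l'
    · subst h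
      exact ih l hl hl'
    · obtain ⟨B, rfl, hB⟩ := (sub l).exists_region_eq hl
      obtain ⟨B', rfl, hB'⟩ := (sub l').exists_region_eq hl'
      exact (T.disjoint_child A j h).mono hB hB'

theorem PartitionScheme.sum_restrict_child (A : N) (j : Fin (T.numWays A)) (κ : Measure X) :
    ∑ l, κ.restrict (T.region (T.child A j l)) = κ.restrict (T.region A) := by
  rw [← T.iUnion_child A j, Measure.restrict_iUnion (T.disjoint_child A j)
    (fun l => T.measurableSet_region _), Measure.sum_fintype]

/-- The law of the random variables attached to the region `A`. -/
def Params.drawLaw (P : Params T) (A : N) : Measure (T.Draw A) :=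
  (decisionLaw (P.rho A) (P.lam A)).prod (Measure.pi fun j => dirichlet (P.alpha A j))

theorem Params.drawLaw_halt_pos {P : Params T} {A : N} (h : T.numWays A ≠ 0 → 0 < P.rho A) :
    0 < P.drawLaw A {d | d.1 = Decision.halt} := by
  have := isProbabilityMeasure_decisionLaw (P.rho_nonneg A) (P.rho_le_one A) (P.lam_nonneg A)
    (P.sum_lam A)
  have := fun j => isProbabilityMeasure_dirichlet (P.alpha_pos A j)
  have hset : {d : T.Draw A | d.1 = Decision.halt} = {Decision.halt} ×ˢ Set.univ := by
    ext d
    simp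
  rw [Params.drawLaw, hset, Measure.prod_prod, measure_univ, mul_one]
  exact decisionLaw_halt_pos h

theorem Params.drawLaw_split_pos {P : Params T} {A : N} {j : Fin (T.numWays A)}
    (hrho : P.rho A < 1) (hlam : 0 < P.lam A j) {p : Fin (T.numParts A j) → ℝ}
    (hp : ∀ l, 0 < p l) (hp1 : ∑ l, p l = 1) {s : ℝ} (hs : s < 1) :
    0 < P.drawLaw A {d | d.1 = Decision.split j ∧ ∀ l, s * p l ≤ d.2 j l} := by
  have := isProbabilityMeasure_decisionLaw (P.rho_nonneg A) (P.rho_le_one A) (P.lam_nonneg A)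
    (P.sum_lam A)
  have := fun j => isProbabilityMeasure_dirichlet (P.alpha_pos A j)
  have hset : {d : T.Draw A | d.1 = Decision.split j ∧ ∀ l, s * p l ≤ d.2 j l} =
      {Decision.split j} ×ˢ (Function.eval j ⁻¹' {θ | ∀ l, s * p l ≤ θ l}) := by
    ext d
    simp
  have hms : MeasurableSet {θ : Fin (T.numParts A j) → ℝ | ∀ l, s * p l ≤ θ l} := by
    rw [Set.ofPred_forall]
    exact MeasurableSet.iInter fun l => measurableSet_le measurable_const (by fun_prop)
  rw [Params.drawLaw, hset, Measure.prod_prod,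
    (measurePreserving_eval (fun j => dirichlet (P.alpha A j)) j).measure_preimage
      hms.nullMeasurableSet]
  exact ENNReal.mul_pos (decisionLaw_split_pos hrho hlam).ne'
    (dirichlet_pos (P.alpha_pos A j) hp hp1 hs).ne'

/-- If a measure `κ` is uniform on each part of a recursive partition, then with positive
probability the random measure dominates a multiple of `κ`. The event only restricts the random
variables of finitely many regions. -/
theorem Params.exists_box {P : Params T} (hT : ∀ A j l, ¬ T.region A ⊆ T.region (T.child A j l))
    (hrho : ∀ A, T.numWays A ≠ 0 → 0 < P.rho A ∧ P.rho A < 1) (hlam : ∀ A j, 0 < P.lam A j)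
    (κ : Measure X) [IsFiniteMeasure κ] (hκ : ∀ A, κ (T.region A) ≠ 0)
    {A : N} (R : T.RecPartition A)
    (hR : ∀ L ∈ R.parts, κ.restrict L = κ L • μ[|L]) {s : ℝ} (hs0 : 0 < s) (hs : s < 1) :
    ∃ (F : Finset N) (t : (B : N) → Set (T.Draw B)) (n : ℕ),
      (∀ B ∈ F, T.region B ⊆ T.region A) ∧ (∀ B, MeasurableSet (t B)) ∧
      (∀ B, 0 < P.drawLaw B (t B)) ∧ ∀ ω : (A : N) → T.Draw A, (∀ B ∈ F, ω B ∈ t B) →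
        ∀ k ≥ n, ENNReal.ofReal s • κ.restrict (T.region A) ≤
          κ (T.region A) • T.stage ω k A := by
  induction R generalizing s with
  | halt A =>
    refine ⟨{A}, fun B => {d | d.1 = Decision.halt}, 0, fun B hB => ?_, fun B => ?_, fun B => ?_,
      fun ω hω k _ => ?_⟩
    · rw [Finset.mem_singleton.1 hB]
    · exact measurable_fst (MeasurableSpace.measurableSet_top (s := {Decision.halt}))
    · exact P.drawLaw_halt_pos fun h => (hrho B h).1
    · have hA : (ω A).1 = Decision.halt := hω A (Finset.mem_singleton_self A)
      have hst : T.stage ω k A = μ[|T.region A] := by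
        cases k with
        | zero => rfl
        | succ k =>
          rw [PartitionScheme.stage]
          cases h : (ω A).1 with
          | halt => rfl
          | split j => rw [h] at hA; cases hA
      rw [hst, ← hR _ rfl]
      refine Measure.le_iff.2 fun B _ => ?_
      rw [Measure.smul_apply, smul_eq_mul]
      exact mul_le_of_le_one_left zero_le (ENNReal.ofReal_le_one.2 hs.le)
  | split A j sub ih =>
    -- One factor √s is spent on the weights at A, the other on the subtrees.
    set s' := Real.sqrt s
    have hs0' : 0 < s' := Real.sqrt_pos.2 hs0
    have hs' : s' < 1 := (Real.sqrt_lt' one_pos).2 (by rwa [one_pow])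
    have hss : ENNReal.ofReal s' * ENNReal.ofReal s' = ENNReal.ofReal s := by
      rw [← ENNReal.ofReal_mul hs0'.le, Real.mul_self_sqrt hs0.le]
    have hsub := fun l => ih l (fun L hL => hR L (Set.mem_iUnion.2 ⟨l, hL⟩)) hs0' hs'
    choose F t n hF htm htp hω using hsub
    set p : Fin (T.numParts A j) → ℝ := fun l =>
      κ.real (T.region (T.child A j l)) / κ.real (T.region A)
    have hκr : ∀ B, 0 < κ.real (T.region B) := fun B =>
      ENNReal.toReal_pos (hκ B) (measure_ne_top _ _)
    have hp : ∀ l, 0 < p l := fun l => div_pos (hκr _) (hκr _)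
    have hp1 : ∑ l, p l = 1 := by
      have h1 : κ (T.region A) = ∑ l, κ (T.region (T.child A j l)) := by
        have := congrArg (fun ρ : Measure X => ρ Set.univ) (T.sum_restrict_child A j κ)
        simpa [Measure.finsetSum_apply] using this.symm
      rw [← Finset.sum_div, div_eq_one_iff_eq (hκr A).ne', measureReal_def, h1,
        ENNReal.toReal_sum fun l _ => measure_ne_top _ _]
      rfl
    set tA : Set (T.Draw A) := {d | d.1 = Decision.split j ∧ ∀ l, s' * p l ≤ d.2 j l}
    have htAm : MeasurableSet tA := by
      refine (measurable_fst (MeasurableSpace.measurableSet_top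
        (s := {Decision.split j}))).inter ?_
      change MeasurableSet {d : T.Draw A | ∀ l, s' * p l ≤ d.2 j l}
      rw [Set.ofPred_forall]
      exact MeasurableSet.iInter fun l => measurableSet_le measurable_const (by fun_prop)
    have hM : T.numWays A ≠ 0 := j.pos.ne'
    have htAp : 0 < P.drawLaw A tA := P.drawLaw_split_pos (hrho A hM).2 (hlam A j) hp hp1 hs'
    -- The constraints at A and in the subtrees never concern the same label: A lies in no F l by
    -- `hT`, and the F l are disjoint because sibling regions are disjoint and regions are nonempty.
    -- Labels without constraint get the event of halting, as any event of positive probability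
    -- would do.
    have hu : ∀ B, ∃ u : Set (T.Draw B), MeasurableSet u ∧ 0 < P.drawLaw B u ∧
        ∀ ω : (A : N) → T.Draw A, ω B ∈ u →
          (B = A → ω A ∈ tA) ∧ ∀ l, B ∈ F l → ω B ∈ t l B := by
      intro B
      by_cases hBA : B = A
      · subst hBA
        exact ⟨tA, htAm, htAp, fun ω h => ⟨fun _ => h, fun l hl => absurd (hF l _ hl) (hT _ j l)⟩⟩
      · by_cases hex : ∃ l, B ∈ F l
        · obtain ⟨l, hl⟩ := hex
          refine ⟨t l B, htm l B, htp l B, fun ω h => ⟨fun h' => absurd h' hBA, fun l' hl' => ?_⟩⟩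
          by_cases hll : l = l'
          · exact hll ▸ h
          · obtain ⟨x, hx⟩ := T.region_nonempty B
            exact absurd (hF l' B hl' hx)
              (Set.disjoint_left.1 (T.disjoint_child A j hll) (hF l B hl hx))
        · refine ⟨_, measurable_fst (MeasurableSpace.measurableSet_top
            (s := {Decision.halt})), P.drawLaw_halt_pos fun h => (hrho B h).1,
            fun ω _ => ⟨fun h' => absurd h' hBA, fun l hl => absurd ⟨l, hl⟩ hex⟩⟩
    choose u hum hup huω using hu
    classical
    -- One more step than the subtrees need, for the division of A itself.
    refine ⟨insert A (Finset.univ.biUnion F), u, Finset.univ.sup n + 1, ?_, hum, hup, ?_⟩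
    · intro B hB
      rcases Finset.mem_insert.1 hB with rfl | hB
      · exact subset_rfl
      · obtain ⟨l, -, hl⟩ := Finset.mem_biUnion.1 hB
        exact (hF l B hl).trans (T.region_child_subset A j l)
    · intro ω hωu k hk
      obtain ⟨hd, hθ⟩ : ω A ∈ tA :=
        (huω A ω (hωu A (Finset.mem_insert_self _ _))).1 rfl
      obtain ⟨k, rfl⟩ : ∃ k', k = k' + 1 := ⟨k - 1, by omega⟩
      have hstage : T.stage ω (k + 1) A =
          ∑ l, ENNReal.ofReal ((ω A).2 j l) • T.stage ω k (T.child A j l) := by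
        rw [PartitionScheme.stage]
        cases h : (ω A).1 with
        | halt => rw [h] at hd; cases hd
        | split i => rw [h] at hd; cases hd; rfl
      rw [hstage, Finset.smul_sum, ← T.sum_restrict_child A j κ, Finset.smul_sum]
      refine Finset.sum_le_sum fun l _ => ?_
      have hl := hω l ω (fun B hB => (huω B ω (hωu B (Finset.mem_insert_of_mem
        (Finset.mem_biUnion.2 ⟨l, Finset.mem_univ l, hB⟩)))).2 l hB) k
        ((Finset.le_sup (Finset.mem_univ l)).trans (Nat.le_of_succ_le_succ hk))
      have hmass : ENNReal.ofReal s' * κ (T.region (T.child A j l)) ≤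
          κ (T.region A) * ENNReal.ofReal ((ω A).2 j l) := by
        have h1 : s' * κ.real (T.region (T.child A j l)) ≤
            κ.real (T.region A) * (ω A).2 j l := by
          have h2 := mul_le_mul_of_nonneg_left (hθ l) (hκr A).le
          have h3 : κ.real (T.region A) * (s' * p l) =
              s' * κ.real (T.region (T.child A j l)) := by
            simp only [p]
            field_simp [(hκr A).ne']
          rwa [h3] at h2
        have h2 := ENNReal.ofReal_le_ofReal h1
        rwa [ENNReal.ofReal_mul hs0'.le, ENNReal.ofReal_mul (hκr A).le, ofReal_measureReal,
          ofReal_measureReal] at h2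
      refine Measure.le_iff.2 fun D _ => ?_
      have hD := hl D
      simp only [Measure.smul_apply, smul_eq_mul] at hD ⊢
      calc ENNReal.ofReal s * κ.restrict (T.region (T.child A j l)) D
          = ENNReal.ofReal s' *
            (ENNReal.ofReal s' * κ.restrict (T.region (T.child A j l)) D) := by
            rw [← mul_assoc, hss]
        _ ≤ ENNReal.ofReal s' *
            (κ (T.region (T.child A j l)) * T.stage ω k (T.child A j l) D) := by gcongr
        _ = ENNReal.ofReal s' * κ (T.region (T.child A j l)) *
            T.stage ω k (T.child A j l) D := (mul_assoc _ _ _).symm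
        _ ≤ κ (T.region A) * ENNReal.ofReal ((ω A).2 j l) *
            T.stage ω k (T.child A j l) D := by gcongr
        _ = _ := mul_assoc _ _ _

variable [IsFiniteMeasure μ]

/-- By independence a box over finitely many labels has positive probability. The domination holds
at all late stages and passes to their setwise limit. -/
theorem Params.UniformlyBounded.exists_event {P : Params T} (hP : P.UniformlyBounded)
    (κ : Measure X) [IsProbabilityMeasure κ] (hκ : ∀ A, κ (T.region A) ≠ 0)
    (R : T.RecPartition T.root) (hR : ∀ L ∈ R.parts, κ.restrict L = κ L • μ[|L])
    {s : ℝ} (hs0 : 0 < s) (hs : s < 1) :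
    ∃ G : Set ((A : N) → T.Draw A), MeasurableSet G ∧ 0 < P.treeLaw G ∧
      ∀ᵐ ω ∂P.treeLaw, ω ∈ G → ENNReal.ofReal s • κ ≤ (T.limitMeasure ω : Measure X) := by
  have hlim := hP.ae_tendsto_stage_apply
  have hT := hP.not_region_subset_child
  obtain ⟨δ, hδ, h⟩ := hP
  obtain ⟨F, t, n, -, htm, htp, hω⟩ := P.exists_box hT
    (fun A hA => ⟨hδ.trans ((h A).1 hA).1, ((h A).1 hA).2.trans (by linarith)⟩)
    (fun A j => hδ.trans_le ((h A).2 j).1) κ hκ R hR hs0 hs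
  refine ⟨Set.pi F t, MeasurableSet.pi F.countable_toSet fun B _ => htm B, ?_, ?_⟩
  · rw [Params.treeLaw, Measure.infinitePi_pi _ fun B _ => htm B]
    exact CanonicallyOrderedAdd.prod_pos.2 fun B _ => htp B
  · filter_upwards [hlim] with ω hωlim hωG
    refine Measure.le_iff.2 fun D hD => ?_
    refine ge_of_tendsto (hωlim D hD) ?_
    filter_upwards [eventually_ge_atTop n] with k hk
    have := hω ω hωG k hk D
    simpa [T.region_root] using this

/-- With s = 1/a, the event G of `exists_event` gives κ ≤ a Q, hence κ^n ≤ a^n Q^n. Integration over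
G gives the claim with c the inverse probability of G, which does not depend on n. -/
theorem Params.UniformlyBounded.exists_pi_le {P : Params T} (hP : P.UniformlyBounded)
    (κ : Measure X) [IsProbabilityMeasure κ] (hκ : ∀ A, κ (T.region A) ≠ 0)
    (R : T.RecPartition T.root) (hR : ∀ L ∈ R.parts, κ.restrict L = κ L • μ[|L])
    {a : ℝ≥0∞} (ha : 1 < a) (ha' : a ≠ ∞) :
    ∃ c : ℝ≥0∞, c ≠ ∞ ∧ ∀ n : ℕ,
      (Measure.pi fun _ : Fin n => κ) ≤ (c * a ^ n) • (jointLaw P.prior n).fst := by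
  have ha0 : a ≠ 0 := (zero_lt_one.trans ha).ne'
  have hs0 : 0 < a⁻¹.toReal :=
    ENNReal.toReal_pos (ENNReal.inv_ne_zero.2 ha') (ENNReal.inv_ne_top.2 ha0)
  have hs : a⁻¹.toReal < 1 := by
    rw [← ENNReal.toReal_one, ENNReal.toReal_lt_toReal (ENNReal.inv_ne_top.2 ha0)
      ENNReal.one_ne_top]
    exact ENNReal.inv_lt_one.2 ha
  obtain ⟨G, hGm, hG, hGω⟩ := hP.exists_event κ hκ R hR hs0 hs
  rw [ENNReal.ofReal_toReal (ENNReal.inv_ne_top.2 ha0)] at hGω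
  refine ⟨(P.treeLaw G)⁻¹, ENNReal.inv_ne_top.2 hG.ne', fun n => ?_⟩
  refine Measure.le_iff.2 fun D hD => ?_
  have hmeas : Measurable fun Q : ProbabilityMeasure X =>
      (Measure.pi fun _ : Fin n => (Q : Measure X)) D :=
    (Measure.measurable_coe hD).comp (measurable_pi_probabilityMeasure n)
  rw [Measure.smul_apply, smul_eq_mul, fst_jointLaw_apply _ _ hD, Params.prior,
    lintegral_map' hmeas.aemeasurable hP.aemeasurable_limitMeasure]
  have hle : (Measure.pi fun _ : Fin n => κ) D * P.treeLaw G ≤ a ^ n *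
      ∫⁻ ω, (Measure.pi fun _ : Fin n => (T.limitMeasure ω : Measure X)) D ∂P.treeLaw := by
    rw [← setLIntegral_const, ← lintegral_const_mul' _ _ (ENNReal.pow_ne_top ha')]
    refine le_trans (lintegral_mono_ae ?_) (setLIntegral_le_lintegral G _)
    rw [ae_restrict_iff' hGm]
    filter_upwards [hGω] with ω hω hωG
    refine pi_apply_le_of_smul_le ha' ?_ n D
    refine Measure.le_iff.2 fun B _ => ?_
    have := hω hωG B
    rw [Measure.smul_apply, smul_eq_mul] at this ⊢
    calc κ B = a * (a⁻¹ * κ B) := by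
          rw [← mul_assoc, ENNReal.mul_inv_cancel ha0 ha', one_mul]
      _ ≤ _ := by gcongr
  rw [mul_assoc, mul_comm (P.treeLaw G)⁻¹, ← div_eq_mul_inv,
    ENNReal.le_div_iff_mul_le (Or.inl hG.ne') (Or.inl (measure_ne_top _ _))]
  exact hle

end Support

/-! ### Approximation by step functions on recursive partitions -/

section Approximation

variable {X : Type*} [MeasurableSpace X]

/-- A bounded function lies between a step function and its translate. -/
theorem exists_step_function (c : ℝ≥0∞) (n : ℕ) {f : X → ℝ≥0∞} (hf : Measurable f)
    (hfn : ∀ x, f x ≤ n * c) :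
    ∃ E : Fin n → Set X, (∀ i, MeasurableSet (E i)) ∧
      ∀ x, ∑ i, (E i).indicator (fun _ => c) x ≤ f x ∧
        f x ≤ ∑ i, (E i).indicator (fun _ => c) x + c := by
  induction n generalizing f with
  | zero =>
    refine ⟨fun i => ∅, fun i => i.elim0, fun x => ?_⟩
    have := hfn x
    simp_all
  | succ n ih =>
    -- One layer of height c is peeled off where f ≥ c; truncated subtraction leaves 0 elsewhere.
    obtain ⟨E, hE, hb⟩ := ih (f := fun x => f x - c) (hf.sub measurable_const) fun x => by
      rw [tsub_le_iff_right]
      refine (hfn x).trans (le_of_eq ?_)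
      push_cast
      ring
    refine ⟨Fin.cons {x | c ≤ f x} E, fun i => ?_, fun x => ?_⟩
    · refine Fin.cases ?_ (fun i => ?_) i
      · exact measurableSet_le measurable_const hf
      · exact hE i
    · rw [Fin.sum_univ_succ]
      simp only [Fin.cons_zero, Fin.cons_succ]
      obtain ⟨h1, h2⟩ := hb x
      by_cases hx : c ≤ f x
      · rw [Set.indicator_of_mem (by exact hx)]
        constructor
        · calc c + ∑ i, (E i).indicator (fun _ => c) x ≤ c + (f x - c) := by gcongr
            _ = f x := add_tsub_cancel_of_le hx
        · calc f x = c + (f x - c) := (add_tsub_cancel_of_le hx).symm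
            _ ≤ c + (∑ i, (E i).indicator (fun _ => c) x + c) := by gcongr
            _ = _ := (add_assoc _ _ _).symm
      · rw [Set.indicator_of_notMem (by exact hx), zero_add]
        have hlt : f x < c := not_le.1 hx
        exact ⟨h1.trans tsub_le_self, hlt.le.trans le_add_self⟩

theorem restrict_withDensity_eq_smul_cond {μ : Measure X} [IsFiniteMeasure μ] {q : X → ℝ≥0∞} {L : Set X} (hL : MeasurableSet L)
    (hμL : μ L ≠ 0) {r : ℝ≥0∞} (hq : ∀ x ∈ L, q x = r) :
    (μ.withDensity q).restrict L = μ.withDensity q L • μ[|L] := by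
  have h1 : μ.withDensity q L = r * μ L := by
    rw [withDensity_apply _ hL, setLIntegral_congr_fun hL hq, setLIntegral_const]
  refine Measure.ext fun B hB => ?_
  rw [Measure.restrict_apply hB, withDensity_apply _ (hB.inter hL),
    setLIntegral_congr_fun (hB.inter hL) (fun x hx => hq x hx.2), setLIntegral_const, h1,
    Measure.smul_apply, smul_eq_mul, cond_apply hL, ← mul_assoc, mul_assoc r,
    ENNReal.mul_inv_cancel hμL (measure_ne_top μ L), mul_one, Set.inter_comm]

variable [TopologicalSpace X] [PolishSpace X] [BorelSpace X] {μ : Measure X} [IsFiniteMeasure μ]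
  {N : Type*} {T : PartitionScheme μ N}

/-- Outer regularity replaces each Borel set by an open one at cost η/2, and the hypothesis on open
sets costs the other half. -/
theorem PartitionScheme.ApproximatesOpenSets.exists_approx (hT : T.ApproximatesOpenSets) {n : ℕ}
    {E : Fin n → Set X} (hE : ∀ i, MeasurableSet (E i)) {η : ℝ≥0∞} (hη : η ≠ 0) :
    ∃ (R : T.RecPartition T.root) (S : Fin n → Set (Set X)),
      ∀ i, S i ⊆ R.parts ∧ μ (symmDiff (E i) (⋃₀ S i)) ≤ η := by
  have hη2 : η / 2 ≠ 0 := (ENNReal.half_pos hη).ne'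
  have hO : ∀ i, ∃ O, E i ⊆ O ∧ IsOpen O ∧ μ (O \ E i) < η / 2 := fun i => by
    obtain ⟨O, h1, h2, -, h3⟩ := (hE i).exists_isOpen_sdiff_lt (measure_ne_top μ _) hη2
    exact ⟨O, h1, h2, h3⟩
  choose O hEO hOo hOμ using hO
  obtain ⟨R, hR⟩ := hT (Set.range O) (Set.finite_range O)
    (by rintro _ ⟨i, rfl⟩; exact hOo i) (η / 2) (pos_iff_ne_zero.2 hη2)
  have hR' := fun i => hR (O i) ⟨i, rfl⟩
  choose S hS hSμ using hR'
  refine ⟨R, S, fun i => ⟨hS i, ?_⟩⟩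
  have hsd : symmDiff (E i) (O i) = O i \ E i := symmDiff_of_le (hEO i)
  calc μ (symmDiff (E i) (⋃₀ S i))
      ≤ μ (symmDiff (E i) (O i)) + μ (symmDiff (O i) (⋃₀ S i)) :=
        measure_symmDiff_le _ _ _
    _ ≤ η / 2 + η / 2 := by
        rw [hsd]
        exact add_le_add (hOμ i).le (hSμ i).le
    _ = η := ENNReal.add_halves η

/-- A bounded function is approximated in `L¹` by functions that are constant on the parts of a
recursive partition. -/
theorem PartitionScheme.ApproximatesOpenSets.exists_approx_fun (hT : T.ApproximatesOpenSets)
    {f : X → ℝ≥0∞} (hf : Measurable f) {C : ℝ≥0} (hfC : ∀ x, f x ≤ C) {η : ℝ≥0∞} (hη : η ≠ 0) :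
    ∃ (R : T.RecPartition T.root) (φ e : X → ℝ≥0∞), Measurable φ ∧ Measurable e ∧
      (∀ L ∈ R.parts, ∃ r, ∀ x ∈ L, φ x = r) ∧ (∀ x, f x ≤ φ x + e x) ∧
      (∀ x, φ x ≤ f x + e x) ∧ ∫⁻ x, e x ∂μ ≤ η := by
  -- Half of η pays for the step height c, the other half for the n symmetric differences, each
  -- weighted by c.
  obtain ⟨c, hc0, hcη⟩ : ∃ c : ℝ≥0, 0 < c ∧ c * μ Set.univ ≤ η / 2 := by
    obtain ⟨c, hc0, hc⟩ := ENNReal.exists_nnreal_pos_mul_lt (measure_ne_top μ Set.univ)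
      (ENNReal.half_pos hη).ne'
    exact ⟨c, hc0, hc.le⟩
  obtain ⟨n, hn⟩ := Archimedean.arch C hc0
  rw [nsmul_eq_mul] at hn
  obtain ⟨E, hE, hb⟩ := exists_step_function (c : ℝ≥0∞) n hf fun x => (hfC x).trans <| by
    exact_mod_cast hn
  obtain ⟨η', hη'0, hη'⟩ : ∃ η' : ℝ≥0, 0 < η' ∧ η' * ((n : ℝ≥0∞) * c) ≤ η / 2 := by
    obtain ⟨c', hc0, hc⟩ := ENNReal.exists_nnreal_pos_mul_lt
      (ENNReal.mul_ne_top (ENNReal.natCast_ne_top n) (ENNReal.coe_ne_top (r := c)))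
      (ENNReal.half_pos hη).ne'
    exact ⟨c', hc0, hc.le⟩
  obtain ⟨R, S, hRS⟩ := hT.exists_approx hE (η := η') (by simpa using hη'0.ne')
  have hSm : ∀ i, MeasurableSet (⋃₀ S i) := fun i => by
    refine MeasurableSet.sUnion (R.finite_parts.subset (hRS i).1).countable fun L hL => ?_
    obtain ⟨B, rfl, -⟩ := R.exists_region_eq ((hRS i).1 hL)
    exact T.measurableSet_region B
  have hDm : ∀ i, MeasurableSet (symmDiff (E i) (⋃₀ S i)) := fun i => (hE i).symmDiff (hSm i)
  refine ⟨R, fun x => ∑ i, (⋃₀ S i).indicator (fun _ => (c : ℝ≥0∞)) x,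
    fun x => ∑ i, (symmDiff (E i) (⋃₀ S i)).indicator (fun _ => (c : ℝ≥0∞)) x + c,
    Finset.measurable_sum _ fun i _ => measurable_const.indicator (hSm i),
    (Finset.measurable_sum _ fun i _ => measurable_const.indicator (hDm i)).add measurable_const,
    fun L hL => ?_, fun x => ?_, fun x => ?_, ?_⟩
  · obtain ⟨B, rfl, -⟩ := R.exists_region_eq hL
    obtain ⟨y, hy⟩ := T.region_nonempty B
    refine ⟨∑ i, (⋃₀ S i).indicator (fun _ => (c : ℝ≥0∞)) y, fun x hx => ?_⟩
    refine Finset.sum_congr rfl fun i _ => ?_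
    -- Distinct parts are disjoint, so a part lies in the union only if it was itself chosen.
    have hmem : ∀ z ∈ T.region B, z ∈ ⋃₀ S i ↔ T.region B ∈ S i := by
      refine fun z hz => ⟨fun hzS => ?_, fun hB => Set.mem_sUnion.2 ⟨_, hB, hz⟩⟩
      obtain ⟨L, hLS, hzL⟩ := hzS
      by_contra hB
      refine Set.disjoint_left.1 (R.disjoint_parts hL ((hRS i).1 hLS) ?_) hz hzL
      rintro rfl
      exact hB hLS
    by_cases hB : T.region B ∈ S i
    · rw [Set.indicator_of_mem ((hmem x hx).2 hB), Set.indicator_of_mem ((hmem y hy).2 hB)]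
    · rw [Set.indicator_of_notMem (mt (hmem x hx).1 hB),
        Set.indicator_of_notMem (mt (hmem y hy).1 hB)]
  · refine (hb x).2.trans ?_
    rw [← add_assoc, ← Finset.sum_add_distrib]
    refine add_le_add_left (Finset.sum_le_sum fun i _ => ?_) _
    by_cases h1 : x ∈ E i <;> by_cases h2 : x ∈ ⋃₀ S i <;>
      simp [Set.indicator, Set.mem_symmDiff, h1, h2, -Set.mem_sUnion]
  · refine le_trans ?_ (add_le_add_left (hb x).1 _)
    rw [← add_assoc, ← Finset.sum_add_distrib]
    refine le_add_of_le_of_nonneg (Finset.sum_le_sum fun i _ => ?_) zero_le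
    by_cases h1 : x ∈ E i <;> by_cases h2 : x ∈ ⋃₀ S i <;>
      simp [Set.indicator, Set.mem_symmDiff, h1, h2, -Set.mem_sUnion]
  · rw [lintegral_add_right _ measurable_const, lintegral_finsetSum _ fun i _ =>
      measurable_const.indicator (hDm i), lintegral_const]
    calc _ ≤ ∑ _i : Fin n, (c : ℝ≥0∞) * η' + η / 2 := by
          gcongr with i
          rw [lintegral_indicator_const (hDm i)]
          gcongr
          exact (hRS i).2
      _ = η' * ((n : ℝ≥0∞) * c) + η / 2 := by
          rw [Finset.sum_const, Finset.card_univ, Fintype.card_fin, nsmul_eq_mul]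
          ring
      _ ≤ η / 2 + η / 2 := by gcongr
      _ = η := ENNReal.add_halves η

end Approximation

/-! ### χ²-approximation of the true density -/

section Consistency

variable {X : Type*} [TopologicalSpace X] [PolishSpace X] [MeasurableSpace X] [BorelSpace X]
  {μ : Measure X} [IsFiniteMeasure μ] {N : Type*} {T : PartitionScheme μ N}

theorem withDensity_inv_mul_sq {f q : ℝ≥0∞} (hq0 : q ≠ 0) (hq : q ≠ ∞) :
    q * (f * q⁻¹) ^ 2 = f * (f * q⁻¹) := by
  calc q * (f * q⁻¹) ^ 2 = f * (f * q⁻¹) * (q * q⁻¹) := by ring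
    _ = _ := by rw [ENNReal.mul_inv_cancel hq0 hq, mul_one]

/-- A distribution with a bounded density is approximated in `χ²`-distance by distributions that
are uniform on each part of some recursive partition. -/
theorem PartitionScheme.ApproximatesOpenSets.exists_chiSquare_le (hT : T.ApproximatesOpenSets)
    {f : X → ℝ≥0∞} (hf : Measurable f) {C : ℝ≥0} (hfC : ∀ x, f x ≤ C)
    (hf1 : ∫⁻ x, f x ∂μ = 1) {x : ℝ≥0} (hx : 0 < x) :
    ∃ (R : T.RecPartition T.root) (ν : Measure X) (h : X → ℝ≥0∞), IsProbabilityMeasure ν ∧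
      (∀ A, ν (T.region A) ≠ 0) ∧ (∀ L ∈ R.parts, ν.restrict L = ν L • μ[|L]) ∧
      Measurable h ∧ μ.withDensity f = ν.withDensity h ∧
      ∫⁻ y, h y ^ 2 ∂ν ≤ (1 + x) * (1 + x) := by
  have hx2 : (x : ℝ≥0∞) / 2 ≠ 0 := (ENNReal.half_pos (by simpa using hx.ne')).ne'
  -- The floor ε makes the approximating density positive, so that it charges every region, and its
  -- inverse bounded. Then η is chosen after ε, so that both η ≤ x/2 and C η/ε ≤ x hold.
  obtain ⟨ε, hε0, hε⟩ := ENNReal.exists_nnreal_pos_mul_lt (measure_ne_top μ Set.univ) hx2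
  have hεne : (ε : ℝ≥0∞) ≠ 0 := by simpa using hε0.ne'
  obtain ⟨η, hη0, hη⟩ := ENNReal.exists_nnreal_pos_mul_lt (a := 1 + C * (ε : ℝ≥0∞)⁻¹)
    (ENNReal.add_ne_top.2 ⟨ENNReal.one_ne_top,
      ENNReal.mul_ne_top ENNReal.coe_ne_top (ENNReal.inv_ne_top.2 hεne)⟩) hx2
  have hη1 : (η : ℝ≥0∞) ≤ x / 2 :=
    (le_mul_of_one_le_right zero_le le_self_add).trans hη.le
  have hη2 : (C : ℝ≥0∞) * (ε : ℝ≥0∞)⁻¹ * η ≤ x := by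
    calc (C : ℝ≥0∞) * (ε : ℝ≥0∞)⁻¹ * η ≤ η * (1 + C * (ε : ℝ≥0∞)⁻¹) := by
          rw [mul_comm]
          gcongr
          exact le_add_self
      _ ≤ x / 2 := hη.le
      _ ≤ x := ENNReal.half_le_self
  obtain ⟨R, φ, e, hφm, hem, hφR, hfφ, hφf, he⟩ := hT.exists_approx_fun hf hfC
    (η := η) (by simpa using hη0.ne')
  set Z := ∫⁻ y, (φ y + ε) ∂μ
  have hZ : Z ≤ 1 + x := by
    calc Z ≤ ∫⁻ y, (f y + e y + ε) ∂μ := lintegral_mono fun y => by gcongr; exact hφf y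
      _ = 1 + ∫⁻ y, e y ∂μ + ε * μ Set.univ := by
          rw [lintegral_add_right _ measurable_const, lintegral_add_right _ hem, hf1,
            lintegral_const]
      _ ≤ 1 + x / 2 + x / 2 := add_le_add (add_le_add_right (he.trans hη1) _) hε.le
      _ = 1 + x := by rw [add_assoc, ENNReal.add_halves]
  have hZtop : Z ≠ ∞ := ne_top_of_le_ne_top (by simp) hZ
  have hμ : μ Set.univ ≠ 0 := by
    rw [← T.region_root]
    exact (T.measure_region_pos _).ne'
  have hZ0 : Z ≠ 0 := by
    refine ((ENNReal.mul_pos hεne hμ).trans_le ?_).ne'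
    rw [← lintegral_const]
    exact lintegral_mono fun y => le_add_self
  have hφtop : ∀ᵐ y ∂μ, φ y ≠ ∞ := by
    have h1 : ∀ᵐ y ∂μ, φ y + ε < ∞ := ae_lt_top (hφm.add measurable_const) hZtop
    filter_upwards [h1] with y hy
    exact (ENNReal.add_lt_top.1 hy).1.ne
  set q : X → ℝ≥0∞ := fun y => Z⁻¹ * (φ y + ε)
  have hqm : Measurable q := (hφm.add measurable_const).const_mul _
  have hq0 : ∀ y, q y ≠ 0 := fun y =>
    mul_ne_zero (ENNReal.inv_ne_zero.2 hZtop) (by simp [hε0.ne'])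
  have hqtop : ∀ᵐ y ∂μ, q y ≠ ∞ := by
    filter_upwards [hφtop] with y hy
    exact ENNReal.mul_ne_top (ENNReal.inv_ne_top.2 hZ0)
      (ENNReal.add_ne_top.2 ⟨hy, ENNReal.coe_ne_top⟩)
  have hhm : Measurable fun y => f y * (q y)⁻¹ := hf.mul hqm.inv
  refine ⟨R, μ.withDensity q, fun y => f y * (q y)⁻¹, ⟨?_⟩, fun A hA => ?_, fun L hL => ?_, hhm,
    ?_, ?_⟩
  · rw [withDensity_apply _ MeasurableSet.univ, Measure.restrict_univ,
      lintegral_const_mul' _ _ (ENNReal.inv_ne_top.2 hZ0)]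
    exact ENNReal.inv_mul_cancel hZ0 hZtop
  · exact (T.measure_region_pos A).ne'
      (withDensity_absolutelyContinuous' hqm.aemeasurable (ae_of_all _ hq0) hA)
  · obtain ⟨r, hr⟩ := hφR L hL
    obtain ⟨B, rfl, -⟩ := R.exists_region_eq hL
    exact restrict_withDensity_eq_smul_cond (T.measurableSet_region B)
      (T.measure_region_pos B).ne' (r := Z⁻¹ * (r + ε)) fun y hy => by simp only [q, hr y hy]
  · rw [← withDensity_mul _ hqm hhm]
    refine withDensity_congr_ae ?_
    filter_upwards [hqtop] with y hy
    rw [Pi.mul_apply, mul_left_comm, ENNReal.mul_inv_cancel (hq0 y) hy, mul_one]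
  · rw [lintegral_withDensity_eq_lintegral_mul _ hqm (hhm.pow_const 2)]
    -- The integrand is f²/q = Z f · f/(φ + ε). Since f ≤ φ + ε + e, the last quotient is at most 1
    -- + e/ε, and f ≤ C is needed only on the error term.
    calc ∫⁻ y, (q * fun y => (f y * (q y)⁻¹) ^ 2) y ∂μ
        ≤ ∫⁻ y, Z * (f y + C * (ε : ℝ≥0∞)⁻¹ * e y) ∂μ := by
          refine lintegral_mono_ae ?_
          filter_upwards [hqtop, hφtop] with y hy hφy
          have hφε0 : φ y + ε ≠ 0 := by simp [hε0.ne']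
          have hφεt : φ y + ε ≠ ∞ := ENNReal.add_ne_top.2 ⟨hφy, ENNReal.coe_ne_top⟩
          have hinv : (q y)⁻¹ = Z * (φ y + ε)⁻¹ := by
            rw [ENNReal.mul_inv (Or.inl (ENNReal.inv_ne_zero.2 hZtop))
              (Or.inl (ENNReal.inv_ne_top.2 hZ0)), inv_inv]
          rw [Pi.mul_apply, withDensity_inv_mul_sq (hq0 y) hy, hinv]
          have h1 : f y * (φ y + ε)⁻¹ ≤ 1 + e y * (ε : ℝ≥0∞)⁻¹ := by
            calc f y * (φ y + ε)⁻¹ ≤ (φ y + ε + e y) * (φ y + ε)⁻¹ := by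
                  gcongr
                  refine (hfφ y).trans ?_
                  gcongr
                  exact le_self_add
              _ = 1 + e y * (φ y + ε)⁻¹ := by
                  rw [add_mul, ENNReal.mul_inv_cancel hφε0 hφεt]
              _ ≤ 1 + e y * (ε : ℝ≥0∞)⁻¹ := by
                  gcongr
                  exact le_add_self
          calc f y * (f y * (Z * (φ y + ε)⁻¹)) = Z * (f y * (f y * (φ y + ε)⁻¹)) := by ring
            _ ≤ Z * (f y * (1 + e y * (ε : ℝ≥0∞)⁻¹)) := by gcongr
            _ = Z * (f y + f y * (ε : ℝ≥0∞)⁻¹ * e y) := by ring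
            _ ≤ _ := by gcongr; exact hfC y
      _ = Z * (1 + C * (ε : ℝ≥0∞)⁻¹ * ∫⁻ y, e y ∂μ) := by
          rw [lintegral_const_mul' _ _ hZtop,
            lintegral_add_left hf, lintegral_const_mul _ hem, hf1]
      _ ≤ (1 + x) * (1 + x) := by
          gcongr
          exact le_trans (by gcongr) hη2

theorem Params.UniformlyBounded.chargesVicinity {P : Params T} (hP : P.UniformlyBounded)
    (hT : T.ApproximatesOpenSets) {Q₀ : Measure X} [IsProbabilityMeasure Q₀] {f : X → ℝ≥0∞}
    (hf : Measurable f) {C : ℝ≥0} (hfC : ∀ x, f x ≤ C) (hQ₀ : Q₀ = μ.withDensity f) :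
    ChargesVicinity P.prior Q₀ := by
  intro a ha
  -- As a may be infinite, a finite b between 1 and a takes its place.
  obtain ⟨b, hb1, hba⟩ := ENNReal.lt_iff_exists_nnreal_btwn.1 ha
  have hb : 1 < b := by exact_mod_cast hb1
  obtain ⟨x, hx, hxb⟩ : ∃ x : ℝ≥0, 0 < x ∧ (1 + x) * (1 + x) ≤ b := by
    refine ⟨min 1 ((b - 1) / 3), lt_min one_pos (div_pos (tsub_pos_of_lt hb) three_pos), ?_⟩
    set x : ℝ≥0 := min 1 ((b - 1) / 3)
    have h1 : x ≤ 1 := min_le_left _ _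
    have h2 : 3 * x ≤ b - 1 := by
      calc 3 * x ≤ 3 * ((b - 1) / 3) := by gcongr; exact min_le_right _ _
        _ = b - 1 := by field_simp
    calc (1 + x) * (1 + x) = 1 + (2 * x + x * x) := by ring
      _ ≤ 1 + (2 * x + x * 1) := by gcongr
      _ = 1 + 3 * x := by ring
      _ ≤ 1 + (b - 1) := by gcongr
      _ = b := add_tsub_cancel_of_le hb.le
  have hf1 : ∫⁻ y, f y ∂μ = 1 := by
    have := measure_univ (μ := Q₀)
    rwa [hQ₀, withDensity_apply _ MeasurableSet.univ, Measure.restrict_univ] at this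
  obtain ⟨R, ν, h, hν, hν0, hνR, hh, hfh, hh2⟩ := hT.exists_chiSquare_le hf hfC hf1 hx
  obtain ⟨c, hc, hdom⟩ := hP.exists_pi_le ν hν0 R hνR hb1 ENNReal.coe_ne_top
  refine ⟨ν, h, c, hν, hh, hQ₀.trans hfh, hh2.trans (le_trans ?_ hba.le), hc, fun n => ?_⟩
  · exact_mod_cast hxb
  · refine (hdom n).trans (Measure.le_iff.2 fun D _ => ?_)
    simp only [Measure.smul_apply, smul_eq_mul]
    gcongr

end Consistency

end OptionalPolyaTree

end

theorem theorem4 {X : Type*} [TopologicalSpace X] [PolishSpace X] [MeasurableSpace X] [BorelSpace X]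
    (μ : Measure X) [IsFiniteMeasure μ] {N : Type*}
    (T : OptionalPolyaTree.PartitionScheme μ N) (hT : T.ApproximatesOpenSets)
    (P : OptionalPolyaTree.Params T) (hP : P.UniformlyBounded)
    (post : ∀ n : ℕ, Kernel (Fin n → X) (ProbabilityMeasure X))
    (hpost : ∀ n, OptionalPolyaTree.IsPosterior P.prior n (post n))
    (Q₀ : ProbabilityMeasure X) (f : X → ℝ≥0∞) (hf : Measurable f) (C : ℝ≥0)
    (hfC : ∀ x, f x ≤ C) (hQ₀ : (Q₀ : Measure X) = μ.withDensity f) :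
    ∀ᵐ x ∂(Measure.infinitePi fun _ : ℕ => (Q₀ : Measure X)),
      ∀ U ∈ 𝓝 Q₀, Tendsto (fun n => post n (fun i => x i) U) atTop (𝓝 1) := by
  have := hP.isProbabilityMeasure_prior
  exact OptionalPolyaTree.ae_tendsto_posterior_nhds (hP.chargesVicinity hT hf hfC hQ₀) hpost
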